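/- Definitions. A Datalog rule over a finite schema is an expression $R_0(\bar x_0) \mathrel{:\!\!-} R_1(\bar x_1),\dots,R_n(\bar x_n)$ with $n\ge 1$, where the $R_i(\bar x_i)$ are constant-free relational atoms and every variable of $\bar x_0$ occurs in some $\bar x_k$, $k\geq 1$; a Datalog program $\Sigma$ is a finite set of rules. A predicate occurring in $\Sigma$ is intensional if it occurs in the head of a rule, and extensional otherwise. $\Sigma$ is non-recursive if its predicate graph (with an edge from $R$ to $P$ whenever $R$ occurs in the body of a rule with head predicate $P$) is acyclic. A non-recursive Datalog query is a pair $Q=(\Sigma,R)$ of a non-recursive program $\Sigma$ and an intensional predicate $R$ of $\Sigma$. For a database $D$ (a finite set of facts) over the extensional predicates of $\Sigma$, with active domain $\mathrm{adom}(D)$, a proof tree of a fact $\alpha$ w.r.t. $D$ and $\Sigma$ is a finite rooted tree whose nodes are labelled with facts over the predicates of $\Sigma$ and the constants of $\mathrm{adom}(D)$, such that the root is labelled with $\alpha$, the leaves are labelled with facts of $D$, and the label of every inner node and the labels of its children are the head and the body of an instance of a rule of $\Sigma$. The support of a proof tree is the set of the labels of its leaves. For $\bar t\in\mathrm{adom}(D)^{\mathrm{ar}(R)}$,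 $\mathrm{why}(\bar t,D,Q)$ is the set of the supports of all proof trees of $R(\bar t)$ w.r.t. $D$ and $\Sigma$. Theorem. For non-recursive Datalog queries, Why-Provenance is in $\mathrm{AC}_0$ in data complexity; that is, for every fixed non-recursive Datalog query $Q=(\Sigma,R)$, the following decision problem is in $\mathrm{AC}_0$: given a database $D$ over the extensional predicates of $\Sigma$, a tuple $\bar t\in\mathrm{adom}(D)^{\mathrm{ar}(R)}$ and a subset $D'\subseteq D$, does $D'\in\mathrm{why}(\bar t,D,Q)$ hold? Here $\mathrm{AC}_0$ is the class of the problems decided by a uniform family of Boolean circuits of constant depth, polynomial size and unbounded fan-in. Uniform means first-order uniform ($\mathrm{DLOGTIME}$-uniform): the direct connection language of the circuits is definable by first-order formulas with order, addition and multiplication. Instances are encoded as bit strings in the usual way: along an enumeration of $\mathrm{adom}(D)$, first the number $n=|\mathrm{adom}(D)|$ as $0^n1$, then the tables of the relations of $D$ and of $D'$, then the components of $\bar t$ with $n$ bits each. -/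

import Mathlib

noncomputable section

namespace WhyProv

/-! ### Datalog -/

/-- Constants and variables come from (distinct copies of) a countably infinite set. -/
abbrev Const : Type := ℕ

/-- Variables. -/
abbrev Var : Type := ℕ

/-- A relational atom `p(args)` over the schema with predicates `P` and arities `ar`, with terms
from `T`. -/
structure Atom {P : Type*} (ar : P → ℕ) (T : Type) where
  pred : P
  args : Fin (ar pred) → T

/-- A fact is an atom that mentions only constants. -/
abbrev Fact {P : Type*} (ar : P → ℕ) := Atom ar Const

/-- The fact obtained from a constant-free atom by the assignment `h`. -/
def Atom.ground {P : Type*} {ar : P → ℕ} (a : Atom ar Var) (h : Var → Const) : Fact ar :=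
  ⟨a.pred, fun i => h (a.args i)⟩

/-- A (constant-free) Datalog rule: a head atom and a non-empty list of body atoms such that every
variable of the head occurs in the body. -/
structure Rule {P : Type*} (ar : P → ℕ) where
  head : Atom ar Var
  body : List (Atom ar Var)
  body_ne_nil : body ≠ []
  safe : ∀ i, ∃ b ∈ body, ∃ j, b.args j = head.args i

/-- A Datalog program is a finite set of rules. -/
abbrev Program {P : Type*} (ar : P → ℕ) := Finset (Rule ar)

/-- A database is a finite set of facts. -/
abbrev Database {P : Type*} (ar : P → ℕ) := Finset (Fact ar)

section Datalog

variable {P : Type*} {ar : P → ℕ}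

/-- The intensional predicates: those in the head of some rule. -/
def Program.idb (Sg : Program ar) : Set P := {p | ∃ σ ∈ Sg, σ.head.pred = p}

/-- The predicates that occur in the program. -/
def Program.sch (Sg : Program ar) : Set P :=
  {p | ∃ σ ∈ Sg, σ.head.pred = p ∨ ∃ b ∈ σ.body, b.pred = p}

/-- The extensional predicates: those that occur in the program, but in no rule head. -/
def Program.edb (Sg : Program ar) : Set P := Sg.sch \ Sg.idb

/-- The predicate graph: there is an edge from `r` to `p` if `r` occurs in the body of a rule whose
head predicate is `p`. -/
def Program.Edge (Sg : Program ar) (r p : P) : Prop :=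
  ∃ σ ∈ Sg, σ.head.pred = p ∧ ∃ b ∈ σ.body, b.pred = r

/-- A program is non-recursive if its predicate graph is acyclic. -/
def Program.NonRecursive (Sg : Program ar) : Prop := ∀ p, ¬ Relation.TransGen Sg.Edge p p

/-- The active domain. -/
def Database.adom (D : Database ar) : Set Const := {c | ∃ α ∈ D, ∃ i, α.args i = c}

/-- `D` is a database over the set `S` of predicates. -/
def Database.Over (D : Database ar) (S : Set P) : Prop := ∀ α ∈ D, α.pred ∈ S

/-- All facts with a predicate of the program and constants of the active domain. -/
def base (D : Database ar) (Sg : Program ar) : Set (Fact ar) :=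
  {α | α.pred ∈ Sg.sch ∧ ∀ i, α.args i ∈ D.adom}

end Datalog

/-- Finite rooted trees with labels in `α`. -/
inductive LTree (α : Type*) where
  | node (label : α) (n : ℕ) (child : Fin n → LTree α) : LTree α

/-- The label of the root. -/
def LTree.root {α : Type*} : LTree α → α
  | .node a _ _ => a

/-- The set of the labels of the leaves. -/
def LTree.support {α : Type*} : LTree α → Set α
  | .node a 0 _ => {a}
  | .node _ (n + 1) c => ⋃ i : Fin (n + 1), (c i).support

/-- All nodes are labelled in `base D Sg`, the leaves are labelled with facts of `D`, and every
inner node is, together with its children, an instance of a rule. (An assignment of the variables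
of the rule is the same as the restriction of an assignment of all variables.) The label of the root
is not restricted further. -/
def LTree.IsProofTree {P : Type*} {ar : P → ℕ} (D : Database ar) (Sg : Program ar) :
    LTree (Fact ar) → Prop
  | .node a n c =>
      a ∈ base D Sg ∧
      (n = 0 → a ∈ D) ∧
      (n ≠ 0 → ∃ σ ∈ Sg, ∃ h : Var → Const, a = σ.head.ground h ∧
        List.ofFn (fun i => (c i).root) = σ.body.map (fun b => b.ground h)) ∧
      ∀ i, (c i).IsProofTree D Sg

/-- A Datalog query: a program and one of its intensional predicates. -/
structure Query {P : Type*} (ar : P → ℕ) where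
  prog : Program ar
  ans : P
  ans_mem : ans ∈ prog.idb

section Why

variable {P : Type*} {ar : P → ℕ}

/-- A query is non-recursive if its program is. -/
def Query.NonRecursive (Q : Query ar) : Prop := Q.prog.NonRecursive

/-- The why-provenance of the tuple `t`: the supports of the proof trees of the fact `R(t)`. -/
def Query.why (Q : Query ar) (D : Database ar) (t : Fin (ar Q.ans) → Const) :
    Set (Set (Fact ar)) :=
  {S | ∃ T : LTree (Fact ar), T.IsProofTree D Q.prog ∧ T.root = ⟨Q.ans, t⟩ ∧ T.support = S}

/-- The instances of the why-provenance problem of the fixed query `Q`: a database `D` over the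
extensional schema, a tuple `t` over the active domain of `D`, and a subset `D'` of `D`. -/
structure Instance (Q : Query ar) where
  D : Database ar
  isOver : D.Over Q.prog.edb
  t : Fin (ar Q.ans) → Const
  t_mem : ∀ i, t i ∈ D.adom
  D' : Database ar
  sub : D' ⊆ D

end Why

/-! ### Encoding of instances as bit strings

As usual, a structure with `n` elements is encoded along an enumeration of its elements: first
`n` in unary, then the tables of all relations, then the distinguished elements. -/

section Encoding

variable {P : Type*} {ar : P → ℕ}

open Classical in
/-- The table of the relation `p` in `D`, one bit for each of the `n ^ ar p` tuples. -/
def relBits (D : Database ar) {n : ℕ} (e : Fin n → Const) (p : P) : List Bool :=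
  List.ofFn fun j : Fin (n ^ ar p) =>
    decide ((⟨p, fun i => e (finFunctionFinEquiv.symm j i)⟩ : Fact ar) ∈ D)

/-- A constant as a table of `n` bits. -/
def constBits {n : ℕ} (e : Fin n → Const) (c : Const) : List Bool :=
  List.ofFn fun j : Fin n => decide (e j = c)

open Classical in
/-- The extensional predicates, in increasing order. -/
def Program.edbList [Fintype P] [LinearOrder P] (Sg : Program ar) : List P :=
  (Finset.univ.filter fun p => p ∈ Sg.edb).sort

/-- The encoding of an instance along the enumeration `e` of its elements: `0ⁿ1`, the tables of
`D`, the tables of `D'`, and the components of `t`. -/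
def Instance.encode [Fintype P] [LinearOrder P] {Q : Query ar} (I : Instance Q) {n : ℕ}
    (e : Fin n → Const) : List Bool :=
  List.replicate n false ++ [true] ++
    Q.prog.edbList.flatMap (relBits I.D e) ++
    Q.prog.edbList.flatMap (relBits I.D' e) ++
    (List.ofFn I.t).flatMap (constBits e)

/-- The why-provenance problem of the fixed query `Q`, as a set of bit strings: the encodings of
all instances `(D, t, D')` with `D' ∈ why(t, D, Q)`, along all enumerations without repetition of
the active domain of `D`. -/
def whyProvenance [Fintype P] [LinearOrder P] (Q : Query ar) : Set (List Bool) :=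
  {w | ∃ (I : Instance Q) (n : ℕ) (e : Fin n → Const), Function.Injective e ∧
    Set.range e = I.D.adom ∧ (I.D' : Set (Fact ar)) ∈ Q.why I.D I.t ∧ w = I.encode e}

end Encoding

/-! ### The circuit class -/

/-- The kind of a gate in a circuit with `N` input bits. -/
inductive GateKind (N : ℕ) where
  | input (i : Fin N) : GateKind N
  | not : GateKind N
  | and : GateKind N
  | or : GateKind N

/-- A Boolean circuit with `N` input bits, set of gates `G`, unbounded fan-in and one output gate.
`wire g h` means that the value of the gate `h` is one of the values that are fed into the gate
`g`. -/
structure Circuit (N : ℕ) (G : Type) where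
  kind : G → GateKind N
  wire : G → G → Prop
  output : G
  input_fanin : ∀ g i, kind g = .input i → ∀ h, ¬ wire g h
  not_fanin : ∀ g, kind g = .not → ∃! h, wire g h
  acyclic : WellFounded fun h g => wire g h

namespace Circuit

variable {N : ℕ} {G : Type}

/-- The value of a gate of some kind, given the values `r h` of the gates `h` with `wire h`. -/
def gateValue (x : Fin N → Bool) (wire : G → Prop) (r : ∀ h, wire h → Prop) : GateKind N → Prop
  | .input i => x i = true
  | .not => ∀ h (hw : wire h), ¬ r h hw
  | .and => ∀ h (hw : wire h), r h hw
  | .or => ∃ (h : G) (hw : wire h), r h hw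

/-- The truth value of a gate on the input `x`. -/
def eval (C : Circuit N G) (x : Fin N → Bool) : G → Prop :=
  C.acyclic.fix fun g r => gateValue x (C.wire g) r (C.kind g)

/-- The value of a gate is computed from the values of the gates that feed it. -/
theorem eval_eq (C : Circuit N G) (x : Fin N → Bool) (g : G) :
    C.eval x g = gateValue x (C.wire g) (fun h _ => C.eval x h) (C.kind g) :=
  C.acyclic.fix_eq _ g

/-- No path has more than `d` wires. -/
def DepthLE (C : Circuit N G) (d : ℕ) : Prop :=
  ∀ l : List G, l.IsChain C.wire → l.length ≤ d + 1

end Circuit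

/-- A family of circuits, one for each input length, each with finitely many gates. -/
structure CircuitFamily where
  Gate : ℕ → Type
  finite : ∀ N, Finite (Gate N)
  circuit : ∀ N, Circuit N (Gate N)

/-- The numerical predicates order, addition and multiplication. -/
inductive NumRel : ℕ → Type
  | le : NumRel 2
  | add : NumRel 3
  | mul : NumRel 3

/-- The first-order language of the numerical predicates. -/
def numLang : FirstOrder.Language := ⟨fun _ => Empty, NumRel⟩

/-- The numerical structure of the numbers `0, …, N`. -/
instance numStructure (N : ℕ) : numLang.Structure (Fin (N + 1)) where
  funMap f := nomatch f
  RelMap r x := match r with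
    | .le => x 0 ≤ x 1
    | .add => (x 0 : ℕ) + x 1 = x 2
    | .mul => (x 0 : ℕ) * x 1 = x 2

namespace CircuitFamily

/-- The circuits decide the set `L` of bit strings. -/
def Decides (F : CircuitFamily) (L : Set (List Bool)) : Prop :=
  ∀ w : List Bool, w ∈ L ↔ (F.circuit w.length).eval w.get (F.circuit w.length).output

/-- The number of gates is bounded by a polynomial in the number of input bits. -/
def PolySize (F : CircuitFamily) : Prop :=
  ∃ p : Polynomial ℕ, ∀ N, Nat.card (F.Gate N) ≤ p.eval N

/-- The depth is bounded by a constant. -/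
def ConstDepth (F : CircuitFamily) : Prop :=
  ∃ d, ∀ N, (F.circuit N).DepthLE d

/-- First-order uniformity (which is `DLOGTIME` uniformity): the gates of the circuit for `N` input
bits can be named by a tag from a fixed finite set and a tuple of fixed length of numbers up to `N`
such that the direct connection language of the circuits in terms of these names (the kinds of the
gates, the input bits read by the input gates, the output gate, and the wires) is defined, for all
`N` at once, by first-order formulas with the numerical predicates. -/
def FOUniform (F : CircuitFamily) : Prop :=
  ∃ (m k : ℕ) (name : ∀ N, F.Gate N → Fin m × (Fin k → Fin (N + 1)))
    (inputF : Fin m → numLang.Formula (Fin k ⊕ Unit))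
    (notF andF orF outputF : Fin m → numLang.Formula (Fin k))
    (wireF : Fin m → Fin m → numLang.Formula (Fin k ⊕ Fin k)),
    ∀ N, Function.Injective (name N) ∧ ∀ (a : Fin m) (v : Fin k → Fin (N + 1)),
      (∀ i : Fin N, (inputF a).Realize (Sum.elim v fun _ => i.castSucc) ↔
        ∃ g, name N g = (a, v) ∧ (F.circuit N).kind g = .input i) ∧
      ((notF a).Realize v ↔ ∃ g, name N g = (a, v) ∧ (F.circuit N).kind g = .not) ∧
      ((andF a).Realize v ↔ ∃ g, name N g = (a, v) ∧ (F.circuit N).kind g = .and) ∧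
      ((orF a).Realize v ↔ ∃ g, name N g = (a, v) ∧ (F.circuit N).kind g = .or) ∧
      ((outputF a).Realize v ↔ name N (F.circuit N).output = (a, v)) ∧
      ∀ (b : Fin m) (u : Fin k → Fin (N + 1)), (wireF a b).Realize (Sum.elim v u) ↔
        ∃ g h, name N g = (a, v) ∧ name N h = (b, u) ∧ (F.circuit N).wire g h

end CircuitFamily

/-- The class of the sets of bit strings that are decided by a uniform family of circuits of
unbounded fan-in, polynomial size and constant depth. -/
def AC0 : Set (Set (List Bool)) :=
  {L | ∃ F : CircuitFamily, F.PolySize ∧ F.ConstDepth ∧ F.FOUniform ∧ F.Decides L}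

end WhyProv

end

/-!
For a non-recursive program, the proof trees of a fact have bounded height and hence bounded
support. So `D' ∈ why(t, D, Q)` is a first-order property of the instance: it says that `D'`
consists of a bounded number of facts `y₁, …, y_k`, and that `R(t)` has a derivation whose set of
leaves is `{y₁, …, y_k}`. Unfolding the derivation along the acyclic predicate graph turns the
latter into a formula that mentions nothing but equality: for each predicate `p` and each `J ⊆ {1,
…, k}` there is a formula for "`p(a)` has a derivation with support `{y_j | j ∈ J}`", which is a
finite disjunction over the rules for `p` and over the ways to write `J` as a union with one part
for each body atom (`bitDef_derives`, `derives_iff_exists_enumeration`). The database itself only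
enters through the condition that the leaves are exactly the facts of `D'`, so derivations are
defined without a database and over arbitrary constants (`Derives`); this makes it easy to pass
between the constants of an instance and the positions in an enumeration of them.

The positions in the encoding of an instance are polynomials in the number of elements and the
components of the facts. Their graphs are definable from addition and multiplication (`NatDef`), so
the whole problem is defined by one first-order sentence over the bit string with the numerical
predicates (`EncodesWhy`, `bitDef_encodesWhy`). An encoding is determined by its length and the
bits at these positions (`HasTables.unique`); hence every bit string that satisfies the sentence is
an encoding.

Finally, first-order definable sets of bit strings are in `AC0` (`mem_AC0_of_uDef`). The gates of
the circuit are the pairs of a subformula, possibly negated, and an assignment of the variables,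
and the direct connection language is first-order definable because the wires only compare
assignments and the kinds of the atomic gates are numerical atomic conditions.
-/

noncomputable section

set_option autoImplicit false

namespace WhyProv

/-! ### Uniform first-order definability -/

section UniformDefinability

variable {L : FirstOrder.Language.{0, 0}} {ι : Type} {M : ι → Type} [∀ i, L.Structure (M i)]
  {α β : Type}

/-- A family of relations, one on each structure `M i`, is uniformly definable if a single formula
defines all of them. The relations are sets of assignments of an arbitrary type `α` of variables. -/
def UDef (L : FirstOrder.Language.{0, 0}) {ι : Type} (M : ι → Type) [∀ i, L.Structure (M i)]
    {α : Type} (S : ∀ i, (α → M i) → Prop) : Prop :=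
  ∃ φ : L.Formula α, ∀ i v, φ.Realize v ↔ S i v

namespace UDef

theorem congr {S T : ∀ i, (α → M i) → Prop} (hT : UDef L M T) (h : ∀ i v, S i v ↔ T i v) :
    UDef L M S := by
  obtain ⟨φ, hφ⟩ := hT
  exact ⟨φ, fun i v => (hφ i v).trans (h i v).symm⟩

theorem const (p : Prop) : UDef L M (fun i (_ : α → M i) => p) := by
  by_cases h : p
  · exact ⟨⊤, fun i v => by simp [h]⟩
  · exact ⟨⊥, fun i v => by simp [h]⟩

theorem not {S : ∀ i, (α → M i) → Prop} (hS : UDef L M S) : UDef L M (fun i v => ¬ S i v) := by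
  obtain ⟨φ, hφ⟩ := hS
  exact ⟨φ.not, fun i v => by rw [FirstOrder.Language.Formula.realize_not, hφ]⟩

theorem and {S T : ∀ i, (α → M i) → Prop} (hS : UDef L M S) (hT : UDef L M T) :
    UDef L M (fun i v => S i v ∧ T i v) := by
  obtain ⟨φ, hφ⟩ := hS
  obtain ⟨ψ, hψ⟩ := hT
  exact ⟨φ ⊓ ψ, fun i v => by rw [FirstOrder.Language.Formula.realize_inf, hφ, hψ]⟩

theorem or {S T : ∀ i, (α → M i) → Prop} (hS : UDef L M S) (hT : UDef L M T) :
    UDef L M (fun i v => S i v ∨ T i v) := by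
  obtain ⟨φ, hφ⟩ := hS
  obtain ⟨ψ, hψ⟩ := hT
  exact ⟨φ ⊔ ψ, fun i v => by rw [FirstOrder.Language.Formula.realize_sup, hφ, hψ]⟩

theorem imp {S T : ∀ i, (α → M i) → Prop} (hS : UDef L M S) (hT : UDef L M T) :
    UDef L M (fun i v => S i v → T i v) := by
  obtain ⟨φ, hφ⟩ := hS
  obtain ⟨ψ, hψ⟩ := hT
  exact ⟨φ.imp ψ, fun i v => by rw [FirstOrder.Language.Formula.realize_imp, hφ, hψ]⟩

theorem iff {S T : ∀ i, (α → M i) → Prop} (hS : UDef L M S) (hT : UDef L M T) :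
    UDef L M (fun i v => S i v ↔ T i v) := by
  obtain ⟨φ, hφ⟩ := hS
  obtain ⟨ψ, hψ⟩ := hT
  exact ⟨φ.iff ψ, fun i v => by rw [FirstOrder.Language.Formula.realize_iff, hφ, hψ]⟩

theorem finite_exists {κ : Type*} [Finite κ] {S : κ → ∀ i, (α → M i) → Prop}
    (hS : ∀ c, UDef L M (S c)) : UDef L M (fun i v => ∃ c, S c i v) := by
  choose φ hφ using hS
  exact ⟨FirstOrder.Language.Formula.iSup φ, fun i v => by
    simp only [← hφ]
    exact FirstOrder.Language.BoundedFormula.realize_iSup⟩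

theorem finite_forall {κ : Type*} [Finite κ] {S : κ → ∀ i, (α → M i) → Prop}
    (hS : ∀ c, UDef L M (S c)) : UDef L M (fun i v => ∀ c, S c i v) := by
  choose φ hφ using hS
  exact ⟨FirstOrder.Language.Formula.iInf φ, fun i v => by
    simp only [← hφ]
    exact FirstOrder.Language.BoundedFormula.realize_iInf⟩

/-- The condition `p` involves neither the structure nor the assignment, so that it is decided when
the formula is chosen. -/
theorem const_imp {p : Prop} {S : ∀ i, (α → M i) → Prop} (h : p → UDef L M S) :
    UDef L M (fun i v => p → S i v) := by
  by_cases hp : p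
  · simpa [hp] using h hp
  · simpa [hp] using const True

theorem const_and {p : Prop} {S : ∀ i, (α → M i) → Prop} (h : p → UDef L M S) :
    UDef L M (fun i v => p ∧ S i v) := by
  by_cases hp : p
  · simpa [hp] using h hp
  · simpa [hp] using const False

theorem comp {S : ∀ i, (β → M i) → Prop} (hS : UDef L M S) (f : β → α) :
    UDef L M (fun i (v : α → M i) => S i (fun x => v (f x))) := by
  obtain ⟨φ, hφ⟩ := hS
  exact ⟨φ.relabel f, fun i v => by rw [FirstOrder.Language.Formula.realize_relabel, hφ]; rfl⟩

theorem exists_tuple [Finite β] {T : ∀ i, (α → M i) → (β → M i) → Prop}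
    (hT : UDef L M fun i (v : α ⊕ β → M i) => T i (fun x => v (.inl x)) (fun y => v (.inr y))) :
    UDef L M (fun i v => ∃ b : β → M i, T i v b) := by
  obtain ⟨φ, hφ⟩ := hT
  refine ⟨φ.iExs β, fun i v => ?_⟩
  refine FirstOrder.Language.BoundedFormula.realize_iExs.trans (exists_congr fun b => ?_)
  exact hφ i (Sum.elim v b)

theorem forall_tuple [Finite β] {T : ∀ i, (α → M i) → (β → M i) → Prop}
    (hT : UDef L M fun i (v : α ⊕ β → M i) => T i (fun x => v (.inl x)) (fun y => v (.inr y))) :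
    UDef L M (fun i v => ∀ b : β → M i, T i v b) := by
  obtain ⟨φ, hφ⟩ := hT
  refine ⟨φ.iAlls β, fun i v => ?_⟩
  refine FirstOrder.Language.BoundedFormula.realize_iAlls.trans (forall_congr' fun b => ?_)
  exact hφ i (Sum.elim v b)

theorem exists_elem {T : ∀ i, (α → M i) → M i → Prop}
    (hT : UDef L M fun i (v : α ⊕ Unit → M i) => T i (fun x => v (.inl x)) (v (.inr ()))) :
    UDef L M (fun i v => ∃ b : M i, T i v b) :=
  (exists_tuple (T := fun i v b => T i v (b ())) hT).congr fun _ _ =>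
    ⟨fun ⟨b, hb⟩ => ⟨fun _ => b, hb⟩, fun ⟨b, hb⟩ => ⟨b (), hb⟩⟩

theorem forall_elem {T : ∀ i, (α → M i) → M i → Prop}
    (hT : UDef L M fun i (v : α ⊕ Unit → M i) => T i (fun x => v (.inl x)) (v (.inr ()))) :
    UDef L M (fun i v => ∀ b : M i, T i v b) :=
  (forall_tuple (T := fun i v b => T i v (b ())) hT).congr fun _ _ =>
    ⟨fun h b => h (b ()), fun h b => h fun _ => b⟩

theorem eq (x y : α) : UDef L M (fun _ v => v x = v y) :=
  ⟨(FirstOrder.Language.Term.var x).equal (FirstOrder.Language.Term.var y), fun i v => by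
    rw [FirstOrder.Language.Formula.realize_equal]; rfl⟩

theorem rel {n : ℕ} (R : L.Relations n) (x : Fin n → α) :
    UDef L M (fun _ v => FirstOrder.Language.Structure.RelMap R (fun j => v (x j))) :=
  ⟨R.formula fun j => FirstOrder.Language.Term.var (x j), fun i v => by
    rw [FirstOrder.Language.Formula.realize_rel]; rfl⟩

end UDef

end UniformDefinability

/-! ### Circuits from first-order sentences -/

/-- The relation symbols of the numerical predicates together with a unary predicate for the input
bits. -/
inductive BitRel : ℕ → Type
  | num {n : ℕ} (r : NumRel n) : BitRel n
  | bit : BitRel 1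

/-- The first-order language of the numerical predicates and the input bits. -/
def bitLang : FirstOrder.Language := ⟨fun _ => Empty, BitRel⟩

/-- The bit string `w` as a structure on the numbers `0, …, |w|`. The predicate `bit` holds at the
positions of the ones; it fails at `|w|`, which is not a position. -/
instance bitStructure (w : List Bool) : bitLang.Structure (Fin (w.length + 1)) where
  funMap f := nomatch f
  RelMap r x := match r with
    | .num r => FirstOrder.Language.Structure.RelMap (L := numLang) r x
    | .bit => w[(x 0 : ℕ)]? = some true

/-- Formulas over the bit string structures whose free variables are `0, …, n - 1`. -/
abbrev BitFormula (n : ℕ) : Type := bitLang.BoundedFormula Empty n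

/-- The variable that a term consists of; there are no function symbols. -/
def termVar {n : ℕ} : bitLang.Term (Empty ⊕ Fin n) → Fin n
  | .var (.inr i) => i
  | .var (.inl e) => nomatch e
  | .func f _ => nomatch f

theorem realize_termVar {n : ℕ} {w : List Bool} (t : bitLang.Term (Empty ⊕ Fin n))
    (v : Empty → Fin (w.length + 1)) (x : Fin n → Fin (w.length + 1)) :
    t.realize (Sum.elim v x) = x (termVar t) := by
  match t with
  | .var (.inr i) => rfl
  | .var (.inl e) => exact nomatch e
  | .func f _ => exact nomatch f

/-- The subformulas of a formula, each with the number of its free variables. -/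
def subformulas : ∀ {n : ℕ}, BitFormula n → Set (Σ n, BitFormula n)
  | n, .imp a b => insert ⟨n, .imp a b⟩ (subformulas a ∪ subformulas b)
  | n, .all a => insert ⟨n, .all a⟩ (subformulas a)
  | n, .falsum => {⟨n, .falsum⟩}
  | n, .equal s t => {⟨n, .equal s t⟩}
  | n, .rel R ts => {⟨n, .rel R ts⟩}

theorem mem_subformulas_self {n : ℕ} (φ : BitFormula n) : ⟨n, φ⟩ ∈ subformulas φ := by
  cases φ <;> simp [subformulas]

theorem finite_subformulas {n : ℕ} (φ : BitFormula n) : (subformulas φ).Finite := by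
  induction φ with
  | imp a b ha hb => exact (ha.union hb).insert _
  | all a ha => exact ha.insert _
  | falsum => exact Set.finite_singleton _
  | equal s t => exact Set.finite_singleton _
  | rel R ts => exact Set.finite_singleton _

/-- `(φ, b)` stands for the value of `φ` if `b = true` and for its negation if `b = false`. This is
the relation between such a pair and the pairs from which it is computed. -/
inductive Feeds : (Σ n, BitFormula n) × Bool → (Σ n, BitFormula n) × Bool → Prop
  | not (ψ : Σ n, BitFormula n) : Feeds (ψ, false) (ψ, true)
  | left {n : ℕ} (a b : BitFormula n) : Feeds (⟨n, .imp a b⟩, true) (⟨n, a⟩, false)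
  | right {n : ℕ} (a b : BitFormula n) : Feeds (⟨n, .imp a b⟩, true) (⟨n, b⟩, true)
  | all {n : ℕ} (a : BitFormula (n + 1)) : Feeds (⟨n, .all a⟩, true) (⟨n + 1, a⟩, true)

theorem subformulas_closed {n : ℕ} (φ : BitFormula n) {s t : (Σ n, BitFormula n) × Bool}
    (h : Feeds s t) (hs : s.1 ∈ subformulas φ) : t.1 ∈ subformulas φ := by
  induction φ with
  | imp a b ha hb =>
    rcases hs with hs | hs | hs
    · obtain ⟨ψ, c⟩ := s
      obtain rfl : ψ = _ := hs
      cases h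
      · exact Or.inl rfl
      · exact Or.inr (Or.inl (mem_subformulas_self a))
      · exact Or.inr (Or.inr (mem_subformulas_self b))
    · exact Or.inr (Or.inl (ha hs))
    · exact Or.inr (Or.inr (hb hs))
  | all a ha =>
    rcases hs with hs | hs
    · obtain ⟨ψ, c⟩ := s
      obtain rfl : ψ = _ := hs
      cases h
      · exact Or.inl rfl
      · exact Or.inr (mem_subformulas_self a)
    · exact Or.inr (ha hs)
  | falsum =>
    obtain ⟨ψ, c⟩ := s
    obtain rfl : ψ = _ := hs
    cases h
    exact rfl
  | equal _ _ =>
    obtain ⟨ψ, c⟩ := s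
    obtain rfl : ψ = _ := hs
    cases h
    exact rfl
  | rel _ _ =>
    obtain ⟨ψ, c⟩ := s
    obtain rfl : ψ = _ := hs
    cases h
    exact rfl

/-- The number of connectives and quantifiers. -/
def formulaSize : ∀ {n : ℕ}, BitFormula n → ℕ
  | _, .imp a b => formulaSize a + formulaSize b + 1
  | _, .all a => formulaSize a + 1
  | _, _ => 0

/-- A bound for the length of the paths that start at a gate for `s`. -/
def feedRank (s : (Σ n, BitFormula n) × Bool) : ℕ :=
  2 * formulaSize s.1.2 + if s.2 then 0 else 1

theorem feedRank_lt {s t : (Σ n, BitFormula n) × Bool} (h : Feeds s t) :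
    feedRank t < feedRank s := by
  cases h <;> simp only [feedRank, formulaSize, if_true, Bool.false_eq_true, if_false] <;> omega

section Kind

open Classical in
/-- The kind of the gate for `(ψ, true)` at the assignment `v`. Atomic formulas with a numerical
predicate are hardwired: a conjunction or a disjunction of nothing. -/
def formulaKind {k N : ℕ} (v : Fin k → Fin (N + 1)) :
    ∀ {n : ℕ}, n ≤ k → BitFormula n → GateKind N
  | _, _, .falsum => .or
  | _, h, .equal s t => if v ((termVar s).castLE h) = v ((termVar t).castLE h) then .and else .or
  | _, h, .rel (.num r) ts =>
    if FirstOrder.Language.Structure.RelMap (L := numLang) r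
      (fun i => v ((termVar (ts i)).castLE h)) then .and else .or
  | _, h, .rel .bit ts =>
    if hv : (v ((termVar (ts 0)).castLE h) : ℕ) < N then .input ⟨_, hv⟩ else .or
  | _, _, .imp _ _ => .or
  | _, _, .all _ => .and

end Kind

section KindDefinability

variable {k n : ℕ}

/-- Definability by one formula in all numerical structures. -/
abbrev NumDef {α : Type} (S : ∀ N, (α → Fin (N + 1)) → Prop) : Prop :=
  UDef numLang (fun N => Fin (N + 1)) S

theorem numDef_le {α : Type} (x y : α) : NumDef fun _ v => v x ≤ v y :=
  (UDef.rel (M := fun N => Fin (N + 1)) (L := numLang) NumRel.le ![x, y]).congr fun _ _ => Iff.rfl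

theorem numDef_lt_last {α : Type} (x : α) : NumDef fun N v => (v x : ℕ) < N := by
  refine (UDef.exists_elem (T := fun N v y => ¬ y ≤ v x) (numDef_le _ _).not).congr
    fun N v => ⟨fun h => ⟨Fin.last N, not_le.2 h⟩, fun ⟨y, hy⟩ => ?_⟩
  have := y.is_le
  rw [not_le, Fin.lt_def] at hy
  omega

theorem numDef_kind_and (h : n ≤ k) (ψ : BitFormula n) :
    NumDef fun _ (v : Fin k → _) => formulaKind v h ψ = .and := by
  match ψ with
  | .falsum => simpa [formulaKind] using UDef.const False
  | .imp a b => simpa [formulaKind] using UDef.const False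
  | .all a => simpa [formulaKind] using UDef.const True
  | .equal s t =>
    refine (UDef.eq ((termVar s).castLE h) ((termVar t).castLE h)).congr fun N v => ?_
    simp only [formulaKind]
    split_ifs <;> simp_all
  | .rel (.num r) ts =>
    refine (UDef.rel (L := numLang) (M := fun N => Fin (N + 1)) r
      fun i => (termVar (ts i)).castLE h).congr fun N v => ?_
    simp only [formulaKind]
    split_ifs <;> simp_all
  | .rel .bit ts =>
    refine (UDef.const False).congr fun N v => ?_
    simp only [formulaKind]
    split_ifs <;> simp_all

theorem numDef_kind_or (h : n ≤ k) (ψ : BitFormula n) :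
    NumDef fun _ (v : Fin k → _) => formulaKind v h ψ = .or := by
  match ψ with
  | .falsum => simpa [formulaKind] using UDef.const True
  | .imp a b => simpa [formulaKind] using UDef.const True
  | .all a => simpa [formulaKind] using UDef.const False
  | .equal s t =>
    refine (UDef.eq ((termVar s).castLE h) ((termVar t).castLE h)).not.congr fun N v => ?_
    simp only [formulaKind]
    split_ifs <;> simp_all
  | .rel (.num r) ts =>
    refine (UDef.rel (L := numLang) (M := fun N => Fin (N + 1)) r
      fun i => (termVar (ts i)).castLE h).not.congr fun N v => ?_
    simp only [formulaKind]
    split_ifs <;> simp_all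
  | .rel .bit ts =>
    refine (numDef_lt_last ((termVar (ts 0)).castLE h)).not.congr fun N v => ?_
    simp only [formulaKind]
    split_ifs <;> simp_all

theorem formulaKind_eq_input {h : n ≤ k} {ψ : BitFormula n} {N : ℕ} {v : Fin k → Fin (N + 1)}
    {i : Fin N} (hi : formulaKind v h ψ = .input i) :
    ∃ ts, ψ = .rel .bit ts ∧ v ((termVar (ts 0)).castLE h) = i.castSucc := by
  match ψ with
  | .falsum => simp [formulaKind] at hi
  | .imp a b => simp [formulaKind] at hi
  | .all a => simp [formulaKind] at hi
  | .equal s t => simp only [formulaKind] at hi; split_ifs at hi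
  | .rel (.num r) ts => simp only [formulaKind] at hi; split_ifs at hi
  | .rel .bit ts =>
    refine ⟨ts, rfl, ?_⟩
    simp only [formulaKind] at hi
    split_ifs at hi with hv
    injection hi with hi
    rw [← hi]
    rfl

theorem formulaKind_ne_not {h : n ≤ k} {ψ : BitFormula n} {N : ℕ} {v : Fin k → Fin (N + 1)} :
    formulaKind v h ψ ≠ .not := by
  match ψ with
  | .falsum => simp [formulaKind]
  | .imp a b => simp [formulaKind]
  | .all a => simp [formulaKind]
  | .equal s t => simp only [formulaKind]; split_ifs <;> simp
  | .rel (.num r) ts => simp only [formulaKind]; split_ifs <;> simp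
  | .rel .bit ts => simp only [formulaKind]; split_ifs <;> simp

theorem numDef_kind_input (h : n ≤ k) (ψ : BitFormula n) :
    NumDef fun N (v : Fin k ⊕ Unit → _) =>
      ∃ i : Fin N, i.castSucc = v (.inr ()) ∧ formulaKind (fun j => v (.inl j)) h ψ = .input i := by
  by_cases hψ : ∃ ts, ψ = .rel .bit ts
  · obtain ⟨ts, rfl⟩ := hψ
    refine ((UDef.eq (.inl ((termVar (ts 0)).castLE h)) (.inr ())).and
      (numDef_lt_last (.inr ()))).congr fun N v => ⟨?_, ?_⟩
    · rintro ⟨i, hi, hk⟩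
      obtain ⟨ts', hts, hv⟩ := formulaKind_eq_input hk
      cases hts
      exact ⟨hv.trans hi, by simp [← hi]⟩
    · rintro ⟨hv, hN⟩
      refine ⟨⟨_, hN⟩, rfl, ?_⟩
      simp [formulaKind, hv, hN]
  · refine (UDef.const False).congr fun N v => ⟨?_, False.elim⟩
    rintro ⟨i, -, hk⟩
    obtain ⟨ts, hts, -⟩ := formulaKind_eq_input hk
    exact hψ ⟨ts, hts⟩

end KindDefinability

section FormulaCircuit

variable (φ : BitFormula 0) {k : ℕ} (hk : ∀ ψ ∈ subformulas φ, ψ.1 ≤ k)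

/-- The gates of the circuit for `φ`: a subformula, a flag for its negation, and an assignment of
`k` variables. Only the variables that are free in the subformula matter. -/
abbrev FormulaGate (φ : BitFormula 0) (k N : ℕ) : Type :=
  ({ψ // ψ ∈ subformulas φ} × Bool) × (Fin k → Fin (N + 1))

/-- The subformula and the flag of a gate. -/
def FormulaGate.tag {φ : BitFormula 0} {k N : ℕ} (g : FormulaGate φ k N) :
    (Σ n, BitFormula n) × Bool := (g.1.1.1, g.1.2)

/-- The wires between the gates. Along a wire to the body of a quantifier the quantified variable,
whose index is the number of free variables of the quantified formula, takes all values; all other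
variables keep their values. -/
def formulaWire {φ : BitFormula 0} {k N : ℕ} (g h : FormulaGate φ k N) : Prop :=
  Feeds g.tag h.tag ∧ ∀ i : Fin k, (h.tag.1.1 = g.tag.1.1 ∨ (i : ℕ) ≠ g.tag.1.1) → h.2 i = g.2 i

/-- The circuit that evaluates the first-order sentence `φ` on the bit strings of length `N`. -/
def formulaCircuit (N : ℕ) : Circuit N (FormulaGate φ k N) where
  kind g := if g.1.2 then formulaKind g.2 (hk _ g.1.1.2) g.1.1.1.2 else .not
  wire := formulaWire
  output := ((⟨_, mem_subformulas_self φ⟩, true), fun _ => 0)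
  input_fanin := by
    rintro ⟨⟨⟨⟨n, ψ⟩, hψ⟩, b⟩, v⟩ i hi h ⟨hf, -⟩
    cases b
    · simp at hi
    · have hψ' : ∃ ts, ψ = .rel .bit ts := (formulaKind_eq_input hi).imp fun _ h => h.1
      obtain ⟨ts, rfl⟩ := hψ'
      obtain ⟨⟨⟨χ, hχ⟩, c⟩, u⟩ := h
      simp only [FormulaGate.tag] at hf
      cases hf
  not_fanin := by
    rintro ⟨⟨⟨ψ, hψ⟩, b⟩, v⟩ hn
    cases b
    · refine ⟨((⟨ψ, hψ⟩, true), v), ⟨Feeds.not ψ, fun _ _ => rfl⟩, ?_⟩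
      rintro ⟨⟨⟨χ, hχ⟩, c⟩, u⟩ ⟨hf, hu⟩
      simp only [FormulaGate.tag] at hf hu
      cases hf
      obtain rfl : u = v := funext fun i => hu i (Or.inl rfl)
      rfl
    · exact absurd hn formulaKind_ne_not
  acyclic := Subrelation.wf (r := InvImage (· < ·) fun g : FormulaGate φ k N => feedRank g.tag)
    (fun h => feedRank_lt h.1) (InvImage.wf _ Nat.lt_wfRel.wf)

variable {φ}

theorem formulaCircuit_depth (N : ℕ) (l : List (FormulaGate φ k N)) (g : FormulaGate φ k N)
    (h : (g :: l).IsChain formulaWire) : l.length ≤ feedRank g.tag := by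
  induction l generalizing g with
  | nil => simp
  | cons g' l ih =>
    rw [List.isChain_cons_cons] at h
    have := feedRank_lt h.1.1
    have := ih g' h.2
    simp only [List.length_cons]
    omega

/-- On the input `w`, the gate for a subformula has the truth value of the subformula. -/
theorem formulaCircuit_eval (w : List Bool) {n : ℕ} (ψ : BitFormula n)
    (hψ : ⟨n, ψ⟩ ∈ subformulas φ) (v : Fin k → Fin (w.length + 1)) :
    (formulaCircuit φ hk w.length).eval w.get ((⟨_, hψ⟩, true), v) ↔
      ψ.Realize (fun e : Empty => nomatch e) fun i => v (i.castLE (hk _ hψ)) := by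
  have hnot : ∀ {n : ℕ} (ψ : BitFormula n) (hψ : ⟨n, ψ⟩ ∈ subformulas φ) v,
      (formulaCircuit φ hk w.length).eval w.get ((⟨_, hψ⟩, false), v) ↔
        ¬ (formulaCircuit φ hk w.length).eval w.get ((⟨_, hψ⟩, true), v) := by
    intro n ψ hψ v
    rw [Circuit.eval_eq]
    simp only [formulaCircuit, Bool.false_eq_true, if_false, Circuit.gateValue]
    refine ⟨fun h => h _ ⟨Feeds.not _, fun _ _ => rfl⟩, ?_⟩
    rintro h ⟨⟨⟨χ, hχ⟩, c⟩, u⟩ ⟨hf, hu⟩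
    simp only [FormulaGate.tag] at hf hu
    cases hf
    obtain rfl : u = v := funext fun i => hu i (Or.inl rfl)
    exact h
  induction ψ generalizing v with
  | falsum =>
    rw [Circuit.eval_eq]
    simp only [formulaCircuit, if_true, formulaKind, Circuit.gateValue]
    refine ⟨?_, False.elim⟩
    rintro ⟨⟨⟨⟨χ, hχ⟩, c⟩, u⟩, ⟨hf, hu⟩, -⟩
    simp only [FormulaGate.tag] at hf
    cases hf
  | equal s t =>
    have hno : ∀ h, ¬ formulaWire (N := w.length) ((⟨_, hψ⟩, true), v) h := by
      rintro ⟨⟨⟨χ, hχ⟩, c⟩, u⟩ ⟨hf, hu⟩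
      simp only [FormulaGate.tag] at hf
      cases hf
    rw [Circuit.eval_eq, FirstOrder.Language.BoundedFormula.Realize]
    simp only [formulaCircuit, if_true, formulaKind, realize_termVar]
    split_ifs with h <;> simp [Circuit.gateValue, hno, h]
  | rel R ts =>
    have hno : ∀ h, ¬ formulaWire (N := w.length) ((⟨_, hψ⟩, true), v) h := by
      rintro ⟨⟨⟨χ, hχ⟩, c⟩, u⟩ ⟨hf, hu⟩
      simp only [FormulaGate.tag] at hf
      cases hf
    rw [Circuit.eval_eq, FirstOrder.Language.BoundedFormula.Realize]
    simp only [realize_termVar]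
    cases R with
    | num r =>
      simp only [formulaCircuit, if_true, formulaKind]
      change _ ↔ FirstOrder.Language.Structure.RelMap (L := numLang) (M := Fin (w.length + 1)) r _
      split_ifs with h <;> simp [Circuit.gateValue, hno, h]
    | bit =>
      simp only [formulaCircuit, if_true, formulaKind]
      change _ ↔ w[((v _ : Fin _) : ℕ)]? = some true
      split_ifs with h <;> simp [Circuit.gateValue, hno, h]
  | imp a b ha hb =>
    have hfa := subformulas_closed φ (Feeds.left a b) hψ
    have hfb := subformulas_closed φ (Feeds.right a b) hψ
    rw [Circuit.eval_eq, FirstOrder.Language.BoundedFormula.realize_imp]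
    refine Iff.trans ?_ (imp_congr (ha hfa v) (hb hfb v))
    rw [imp_iff_not_or, ← hnot]
    simp only [formulaCircuit, if_true, formulaKind, Circuit.gateValue]
    constructor
    · rintro ⟨⟨⟨⟨χ, hχ⟩, c⟩, u⟩, ⟨hf, hu⟩, he⟩
      simp only [FormulaGate.tag] at hf hu
      cases hf <;> obtain rfl : u = v := funext fun i => hu i (Or.inl rfl)
      · exact Or.inl he
      · exact Or.inr he
    · rintro (h | h)
      · exact ⟨((⟨_, hfa⟩, false), v), ⟨Feeds.left a b, fun _ _ => rfl⟩, h⟩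
      · exact ⟨((⟨_, hfb⟩, true), v), ⟨Feeds.right a b, fun _ _ => rfl⟩, h⟩
  | @all n a ha =>
    have hfa := subformulas_closed φ (Feeds.all a) hψ
    have hn : n < k := hk _ hfa
    rw [Circuit.eval_eq, FirstOrder.Language.BoundedFormula.realize_all]
    simp only [formulaCircuit, if_true, formulaKind, Circuit.gateValue]
    have hsnoc : ∀ u : Fin k → Fin (w.length + 1), (∀ i : Fin k, (i : ℕ) ≠ n → u i = v i) →
        (fun i : Fin (n + 1) => u (i.castLE (hk _ hfa))) =
          Fin.snoc (fun i : Fin n => v (i.castLE (hk _ hψ))) (u ⟨n, hn⟩) := by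
      intro u hu
      funext i
      refine Fin.lastCases ?_ (fun i => ?_) i
      · rw [Fin.snoc_last]; rfl
      · rw [Fin.snoc_castSucc]
        exact hu _ (by simpa using i.2.ne)
    constructor
    · intro h x
      have := h ((⟨_, hfa⟩, true), Function.update v ⟨n, hn⟩ x) ⟨Feeds.all a, fun i hi => ?_⟩
      · have := (ha hfa _).1 this
        rwa [hsnoc _ fun i hi => Function.update_of_ne (fun e => hi (by rw [e])) _ _,
          Function.update_self] at this
      · simp only [FormulaGate.tag] at hi
        exact Function.update_of_ne (fun e => by simp [e] at hi) _ _
    · rintro h ⟨⟨⟨χ, hχ⟩, c⟩, u⟩ ⟨hf, hu⟩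
      simp only [FormulaGate.tag] at hf hu
      cases hf
      refine (ha hfa u).2 ?_
      rw [hsnoc u fun i hi => hu i (Or.inr hi)]
      exact h _

/-- The circuits of a first-order sentence. -/
def formulaFamily : CircuitFamily where
  Gate N := FormulaGate φ k N
  finite N := by
    have := (finite_subformulas φ).to_subtype
    infer_instance
  circuit N := formulaCircuit φ hk N

theorem formulaFamily_uniform : (formulaFamily hk).FOUniform := by
  have := (finite_subformulas φ).to_subtype
  obtain ⟨m, ⟨f⟩⟩ := Finite.exists_equiv_fin ({ψ // ψ ∈ subformulas φ} × Bool)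
  have hin : ∀ t : {ψ // ψ ∈ subformulas φ} × Bool, NumDef fun N (v : Fin k ⊕ Unit → _) =>
      ∃ i : Fin N, i.castSucc = v (.inr ()) ∧
        (formulaCircuit φ hk N).kind (t, fun j => v (.inl j)) = .input i := by
    rintro ⟨t, _ | _⟩
    · simpa [formulaCircuit] using UDef.const False
    · simpa [formulaCircuit] using numDef_kind_input (hk _ t.2) t.1.2
  have hnot : ∀ t : {ψ // ψ ∈ subformulas φ} × Bool, NumDef fun N (v : Fin k → _) =>
      (formulaCircuit φ hk N).kind (t, v) = .not := by
    rintro ⟨t, _ | _⟩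
    · simpa [formulaCircuit] using UDef.const True
    · simpa [formulaCircuit, formulaKind_ne_not] using UDef.const False
  have hand : ∀ t : {ψ // ψ ∈ subformulas φ} × Bool, NumDef fun N (v : Fin k → _) =>
      (formulaCircuit φ hk N).kind (t, v) = .and := by
    rintro ⟨t, _ | _⟩
    · simpa [formulaCircuit] using UDef.const False
    · simpa [formulaCircuit] using numDef_kind_and (hk _ t.2) t.1.2
  have hor : ∀ t : {ψ // ψ ∈ subformulas φ} × Bool, NumDef fun N (v : Fin k → _) =>
      (formulaCircuit φ hk N).kind (t, v) = .or := by
    rintro ⟨t, _ | _⟩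
    · simpa [formulaCircuit] using UDef.const False
    · simpa [formulaCircuit] using numDef_kind_or (hk _ t.2) t.1.2
  have hout : ∀ t : {ψ // ψ ∈ subformulas φ} × Bool, NumDef fun N (v : Fin k → _) =>
      (formulaCircuit φ hk N).output = (t, v) := by
    intro t
    refine (UDef.const_and (p := (⟨_, mem_subformulas_self φ⟩, true) = t) fun _ =>
      UDef.finite_forall fun i : Fin k => UDef.forall_elem (T := fun N v y => v i ≤ y)
        (numDef_le _ _)).congr fun N v => ?_
    simp only [formulaCircuit, Prod.mk.injEq, funext_iff]
    refine and_congr_right fun _ => forall_congr' fun i => ?_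
    exact ⟨fun h y => h ▸ Fin.zero_le y, fun h => (Fin.le_zero_iff.1 (h 0)).symm⟩
  have hwire : ∀ t s : {ψ // ψ ∈ subformulas φ} × Bool, NumDef fun N (v : Fin k ⊕ Fin k → _) =>
      (formulaCircuit φ hk N).wire (t, fun j => v (.inl j)) (s, fun j => v (.inr j)) :=
    fun t s => UDef.const_and (p := Feeds (t.1.1, t.2) (s.1.1, s.2)) fun _ =>
      UDef.finite_forall fun i : Fin k =>
        UDef.const_imp (p := s.1.1.1 = t.1.1.1 ∨ (i : ℕ) ≠ t.1.1.1) fun _ =>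
          UDef.eq (Sum.inr i) (Sum.inl i)
  choose inF hinF using hin
  choose notF hnotF using hnot
  choose andF handF using hand
  choose orF horF using hor
  choose outF houtF using hout
  choose wireF hwireF using hwire
  have hname : ∀ {N : ℕ} {g : FormulaGate φ k N} {a : Fin m} {v : Fin k → Fin (N + 1)},
      (f g.1, g.2) = (a, v) ↔ g = (f.symm a, v) := by
    rintro N ⟨t, u⟩ a v
    simp [Prod.ext_iff, Equiv.eq_symm_apply]
  have hex : ∀ {N : ℕ} {a : Fin m} {v : Fin k → Fin (N + 1)} (p : FormulaGate φ k N → Prop),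
      (∃ g : FormulaGate φ k N, (f g.1, g.2) = (a, v) ∧ p g) ↔ p (f.symm a, v) := by
    intro N a v p
    simp only [hname, exists_eq_left]
  refine ⟨m, k, fun N g => (f g.1, g.2), fun a => inF (f.symm a), fun a => notF (f.symm a),
    fun a => andF (f.symm a), fun a => orF (f.symm a), fun a => outF (f.symm a),
    fun a b => wireF (f.symm a) (f.symm b), fun N => ⟨?_, fun a v => ⟨?_, ?_, ?_, ?_, ?_, ?_⟩⟩⟩
  · rintro ⟨t, u⟩ ⟨s, v⟩ h
    simp only [Prod.mk.injEq, EmbeddingLike.apply_eq_iff_eq] at h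
    rw [h.1, h.2]
  · intro i
    rw [hinF]
    simp only [Sum.elim_inr, Sum.elim_inl, Fin.castSucc_inj, exists_eq_left]
    exact (hex fun g => (formulaCircuit φ hk N).kind g = .input i).symm
  · exact (hnotF _ _ _).trans (hex fun g => (formulaCircuit φ hk N).kind g = .not).symm
  · exact (handF _ _ _).trans (hex fun g => (formulaCircuit φ hk N).kind g = .and).symm
  · exact (horF _ _ _).trans (hex fun g => (formulaCircuit φ hk N).kind g = .or).symm
  · exact (houtF _ _ _).trans hname.symm
  · intro b u
    refine (hwireF _ _ _ _).trans ⟨fun h => ⟨_, _, hname.2 rfl, hname.2 rfl, h⟩, ?_⟩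
    rintro ⟨g, h, hg, hh, hw⟩
    obtain rfl := hname.1 hg
    obtain rfl := hname.1 hh
    exact hw

/-- A set of bit strings that is defined by a first-order sentence with the numerical predicates is
in `AC0`. -/
theorem mem_AC0_of_uDef {L : Set (List Bool)}
    (hL : UDef bitLang (fun w : List Bool => Fin (w.length + 1))
      fun w (_ : Empty → _) => w ∈ L) : L ∈ AC0 := by
  obtain ⟨φ, hφ⟩ := hL
  obtain ⟨k, hk⟩ : ∃ k, ∀ ψ ∈ subformulas φ, ψ.1 ≤ k :=
    ((finite_subformulas φ).image fun ψ => ψ.1).bddAbove.imp fun k h ψ hψ => h ⟨ψ, hψ, rfl⟩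
  have hfin := (finite_subformulas φ).to_subtype
  obtain ⟨d, hd⟩ : ∃ d, ∀ t : {ψ // ψ ∈ subformulas φ} × Bool, feedRank (t.1.1, t.2) ≤ d :=
    (Set.finite_range fun t : {ψ // ψ ∈ subformulas φ} × Bool =>
      feedRank (t.1.1, t.2)).bddAbove.imp fun d h t => h ⟨t, rfl⟩
  refine ⟨formulaFamily hk, ?_, ⟨d, fun N l hl => ?_⟩, formulaFamily_uniform hk, fun w => ?_⟩
  · refine ⟨Polynomial.C (Nat.card ({ψ // ψ ∈ subformulas φ} × Bool)) *
      (Polynomial.X + 1) ^ k, fun N => ?_⟩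
    change Nat.card (({ψ // ψ ∈ subformulas φ} × Bool) × (Fin k → Fin (N + 1))) ≤ _
    rw [Nat.card_prod]
    simp
  · cases l with
    | nil => simp
    | cons g l =>
      exact Nat.succ_le_succ ((formulaCircuit_depth N l g hl).trans (hd g.1))
  · refine ((hφ w fun e => nomatch e).symm.trans ?_).trans
      (formulaCircuit_eval hk w φ (mem_subformulas_self φ) _).symm
    refine iff_of_eq ?_
    rw [FirstOrder.Language.Formula.Realize]
    congr 1
    funext i
    exact i.elim0

end FormulaCircuit

/-! ### Arithmetic in bit strings -/

section Arithmetic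

variable {α β : Type}

/-- Definability by one formula in all bit string structures. -/
abbrev BitDef (S : ∀ w : List Bool, (α → Fin (w.length + 1)) → Prop) : Prop :=
  UDef bitLang (fun w : List Bool => Fin (w.length + 1)) S

/-- A natural number that depends on an assignment is definable if its graph is. Values that exceed
the length of the bit string are allowed; they do not occur in the graph. -/
def NatDef (f : ∀ w : List Bool, (α → Fin (w.length + 1)) → ℕ) : Prop :=
  BitDef fun w (v : α ⊕ Unit → _) => (v (.inr ()) : ℕ) = f w fun x => v (.inl x)

theorem bitDef_le (x y : α) : BitDef fun _ v => v x ≤ v y :=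
  (UDef.rel (M := fun w : List Bool => Fin (w.length + 1)) (L := bitLang)
    (BitRel.num NumRel.le) ![x, y]).congr fun _ _ => Iff.rfl

theorem bitDef_lt (x y : α) : BitDef fun _ v => v x < v y :=
  (bitDef_le y x).not.congr fun _ _ => not_le.symm

theorem bitDef_add (x y z : α) : BitDef fun _ v => (v x : ℕ) + v y = v z :=
  (UDef.rel (M := fun w : List Bool => Fin (w.length + 1)) (L := bitLang)
    (BitRel.num NumRel.add) ![x, y, z]).congr fun _ _ => Iff.rfl

theorem bitDef_mul (x y z : α) : BitDef fun _ v => (v x : ℕ) * v y = v z :=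
  (UDef.rel (M := fun w : List Bool => Fin (w.length + 1)) (L := bitLang)
    (BitRel.num NumRel.mul) ![x, y, z]).congr fun _ _ => Iff.rfl

theorem bitDef_bit (x : α) : BitDef fun w v => w[(v x : ℕ)]? = some true :=
  (UDef.rel (M := fun w : List Bool => Fin (w.length + 1)) (L := bitLang)
    BitRel.bit ![x]).congr fun _ _ => Iff.rfl

namespace NatDef

variable {f g : ∀ w : List Bool, (α → Fin (w.length + 1)) → ℕ}

theorem comp (hf : NatDef f) (r : α → β) :
    NatDef fun w (v : β → _) => f w fun x => v (r x) :=
  UDef.comp hf (Sum.map r id)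

theorem var_eq (hf : NatDef f) (x : α) : BitDef fun w v => (v x : ℕ) = f w v :=
  UDef.comp hf (Sum.elim id fun _ => x)

theorem var (x : α) : NatDef fun _ v => (v x : ℕ) :=
  (UDef.eq (Sum.inr ()) (Sum.inl x)).congr fun _ _ => Fin.val_inj

theorem zero : NatDef fun _ (_ : α → _) => 0 :=
  (bitDef_add (Sum.inr ()) (Sum.inr ()) (Sum.inr ())).congr fun _ _ => by simp

/-- The one is the only number other than zero that is its own square. -/
theorem one : NatDef fun _ (_ : α → _) => 1 := by
  refine ((bitDef_mul (Sum.inr ()) (Sum.inr ()) (Sum.inr ())).and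
    (bitDef_add (Sum.inr ()) (Sum.inr ()) (Sum.inr ())).not).congr fun _ v => ?_
  generalize (v (Sum.inr ()) : ℕ) = m
  refine ⟨by rintro rfl; simp, fun ⟨h₁, h₂⟩ => ?_⟩
  exact Nat.eq_of_mul_eq_mul_left (by omega : 0 < m) (by rw [h₁, mul_one])

theorem add (hf : NatDef f) (hg : NatDef g) : NatDef fun w v => f w v + g w v := by
  refine (UDef.exists_elem (M := fun w : List Bool => Fin (w.length + 1))
    (T := fun w (v : α ⊕ Unit → Fin (w.length + 1)) y => ∃ z : Fin (w.length + 1),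
      (y : ℕ) = f w (fun x => v (.inl x)) ∧ (z : ℕ) = g w (fun x => v (.inl x)) ∧
        (y : ℕ) + z = v (.inr ())) <| UDef.exists_elem <|
    (var_eq (hf.comp fun x => Sum.inl (Sum.inl (Sum.inl x))) (Sum.inl (Sum.inr ()))).and <|
    (var_eq (hg.comp fun x => Sum.inl (Sum.inl (Sum.inl x))) (Sum.inr ())).and <|
    bitDef_add (Sum.inl (Sum.inr ())) (Sum.inr ()) (Sum.inl (Sum.inl (Sum.inr ())))).congr
      fun w v => ⟨fun h => ?_, ?_⟩
  · beta_reduce at h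
    have := (v (.inr ())).2
    exact ⟨⟨f w fun x => v (.inl x), by omega⟩, ⟨g w fun x => v (.inl x), by omega⟩, rfl, rfl,
      h.symm⟩
  · rintro ⟨y, z, hy, hz, h⟩
    rw [← h, hy, hz]

/-- A product with a factor that exceeds the length of the bit string can have the value zero. -/
theorem mul (hf : NatDef f) (hg : NatDef g) : NatDef fun w v => f w v * g w v := by
  have hzero : ∀ {f : ∀ w : List Bool, (α → Fin (w.length + 1)) → ℕ}, NatDef f →
      BitDef fun w (v : α ⊕ Unit → _) => f w (fun x => v (.inl x)) = 0 := by
    intro f hf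
    refine (UDef.exists_elem (M := fun w : List Bool => Fin (w.length + 1))
      (T := fun w (v : α ⊕ Unit → Fin (w.length + 1)) y =>
        (y : ℕ) = f w (fun x => v (.inl x)) ∧ (y : ℕ) = 0) <|
      (var_eq (hf.comp fun x => Sum.inl (Sum.inl x)) (Sum.inr ())).and <|
      zero.var_eq (Sum.inr ())).congr fun w v => ⟨fun h => ⟨0, by simp [h]⟩, ?_⟩
    rintro ⟨y, h₁, h₂⟩
    rw [← h₁, h₂]
  refine ((UDef.exists_elem (M := fun w : List Bool => Fin (w.length + 1))
    (T := fun w (v : α ⊕ Unit → Fin (w.length + 1)) y => ∃ z : Fin (w.length + 1),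
      (y : ℕ) = f w (fun x => v (.inl x)) ∧ (z : ℕ) = g w (fun x => v (.inl x)) ∧
        (y : ℕ) * z = v (.inr ())) <| UDef.exists_elem <|
    (var_eq (hf.comp fun x => Sum.inl (Sum.inl (Sum.inl x))) (Sum.inl (Sum.inr ()))).and <|
    (var_eq (hg.comp fun x => Sum.inl (Sum.inl (Sum.inl x))) (Sum.inr ())).and <|
    bitDef_mul (Sum.inl (Sum.inr ())) (Sum.inr ()) (Sum.inl (Sum.inl (Sum.inr ())))).or <|
      (zero.var_eq (Sum.inr ())).and <| (hzero hf).or (hzero hg)).congr fun w v => ⟨fun h => ?_, ?_⟩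
  · by_cases h₀ : f w (fun x => v (.inl x)) = 0 ∨ g w (fun x => v (.inl x)) = 0
    · exact Or.inr ⟨h.trans (by simpa using h₀), h₀⟩
    · beta_reduce at h
      have := (v (.inr ())).2
      rw [not_or] at h₀
      have h₁ := Nat.le_mul_of_pos_right (f w fun x => v (.inl x)) (Nat.pos_of_ne_zero h₀.2)
      have h₂ := Nat.le_mul_of_pos_left (g w fun x => v (.inl x)) (Nat.pos_of_ne_zero h₀.1)
      exact Or.inl ⟨⟨f w fun x => v (.inl x), by omega⟩, ⟨g w fun x => v (.inl x), by omega⟩,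
        rfl, rfl, h.symm⟩
  · rintro (⟨y, z, hy, hz, h⟩ | ⟨h, h₀⟩)
    · rw [← h, hy, hz]
    · rw [h, eq_comm]
      simpa using h₀

theorem natConst (c : ℕ) : NatDef fun _ (_ : α → _) => c := by
  induction c with
  | zero => exact zero
  | succ c ih => exact ih.add one

theorem pow (hf : NatDef f) (c : ℕ) : NatDef fun w v => f w v ^ c := by
  induction c with
  | zero => simpa using one
  | succ c ih => simpa only [pow_succ] using ih.mul hf

theorem finset_sum {κ : Type*} (s : Finset κ)
    {f : κ → ∀ w : List Bool, (α → Fin (w.length + 1)) → ℕ} (hf : ∀ c, NatDef (f c)) :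
    NatDef fun w v => ∑ c ∈ s, f c w v := by
  classical
  induction s using Finset.induction_on with
  | empty => simpa using zero
  | insert c s hc ih => simpa only [Finset.sum_insert hc] using (hf c).add ih

theorem list_sum {κ : Type*} (l : List κ)
    {f : κ → ∀ w : List Bool, (α → Fin (w.length + 1)) → ℕ} (hf : ∀ c, NatDef (f c)) :
    NatDef fun w v => (l.map fun c => f c w v).sum := by
  induction l with
  | nil => simpa using zero
  | cons c l ih => simpa only [List.map_cons, List.sum_cons] using (hf c).add ih

theorem bit (hf : NatDef f) : BitDef fun w v => w[f w v]? = some true := by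
  refine (UDef.exists_elem (M := fun w : List Bool => Fin (w.length + 1))
    (T := fun w v y => (y : ℕ) = f w v ∧ w[(y : ℕ)]? = some true) <|
    (var_eq (hf.comp Sum.inl) (Sum.inr ())).and (bitDef_bit (Sum.inr ()))).congr
      fun w v => ⟨fun h => ?_, ?_⟩
  · obtain ⟨hlt, -⟩ := List.getElem?_eq_some_iff.1 h
    exact ⟨⟨f w v, by omega⟩, rfl, h⟩
  · rintro ⟨y, hy, h⟩
    rwa [hy] at h

theorem length_eq (hf : NatDef f) : BitDef fun w v => w.length = f w v := by
  refine (UDef.exists_elem (M := fun w : List Bool => Fin (w.length + 1))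
    (T := fun w v y => (y : ℕ) = f w v ∧ ∀ z, z ≤ y) <|
    (var_eq (hf.comp Sum.inl) (Sum.inr ())).and <|
      UDef.forall_elem (bitDef_le (Sum.inr ()) (Sum.inl (Sum.inr ())))).congr
      fun w v => ⟨fun h => ?_, ?_⟩
  · exact ⟨Fin.last _, h, Fin.le_last⟩
  · rintro ⟨y, hy, h⟩
    rw [← hy, Fin.last_le_iff.1 (h (Fin.last _)), Fin.val_last]

end NatDef

end Arithmetic

/-! ### Derivations -/

section Derivations

variable {P : Type*} {ar : P → ℕ}

/-- The atom obtained by renaming the terms. For constant-free atoms and an assignment of constants,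
this is `Atom.ground`. -/
def Atom.map {C C' : Type} (f : C → C') (a : Atom ar C) : Atom ar C' :=
  ⟨a.pred, fun i => f (a.args i)⟩

/-- `Derives Sg α S` means that there is a proof tree of the fact `α` with support `S` in which all
leaves have predicates that are not intensional. The database plays no role, and the constants may
come from any type. -/
inductive Derives (Sg : Program ar) {C : Type} : Atom ar C → Set (Atom ar C) → Prop
  | leaf (α : Atom ar C) (hα : α.pred ∉ Sg.idb) : Derives Sg α {α}
  | node (σ : Rule ar) (hσ : σ ∈ Sg) (h : Var → C) (S : Fin σ.body.length → Set (Atom ar C))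
      (hS : ∀ i, Derives Sg ((σ.body.get i).map h) (S i)) : Derives Sg (σ.head.map h) (⋃ i, S i)

theorem Derives.map {Sg : Program ar} {C C' : Type} (f : C → C') {α : Atom ar C}
    {S : Set (Atom ar C)} (h : Derives Sg α S) : Derives Sg (α.map f) (Atom.map f '' S) := by
  induction h with
  | leaf α hα =>
    rw [Set.image_singleton]
    exact .leaf _ hα
  | node σ hσ h S _ ih =>
    rw [Set.image_iUnion]
    exact .node σ hσ (f ∘ h) _ ih

theorem Derives.nonempty {Sg : Program ar} {C : Type} {α : Atom ar C} {S : Set (Atom ar C)}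
    (h : Derives Sg α S) : S.Nonempty := by
  induction h with
  | leaf α hα => exact Set.singleton_nonempty α
  | node σ hσ h S _ ih =>
    exact Set.nonempty_iUnion.2 ⟨⟨0, List.length_pos_of_ne_nil σ.body_ne_nil⟩, ih _⟩

theorem LTree.support_node {α : Type*} (a : α) {n : ℕ} (c : Fin n → LTree α) (hn : n ≠ 0) :
    (LTree.node a n c).support = ⋃ i, (c i).support := by
  cases n with
  | zero => exact absurd rfl hn
  | succ n => rw [LTree.support]

theorem LTree.IsProofTree.root_mem {D : Database ar} {Sg : Program ar} {T : LTree (Fact ar)}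
    (hT : T.IsProofTree D Sg) : T.root ∈ base D Sg := by
  cases T with
  | node a n c =>
    rw [LTree.IsProofTree] at hT
    exact hT.1

theorem LTree.IsProofTree.derives {D : Database ar} {Sg : Program ar} (hD : D.Over Sg.edb)
    {T : LTree (Fact ar)} (hT : T.IsProofTree D Sg) :
    Derives Sg T.root T.support ∧ T.support ⊆ D := by
  induction T with
  | node a n c ih =>
    rw [LTree.IsProofTree] at hT
    obtain ⟨-, hleaf, hinner, hc⟩ := hT
    rcases eq_or_ne n 0 with rfl | hn
    · rw [LTree.support, Set.singleton_subset_iff]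
      exact ⟨.leaf a (hD a (hleaf rfl)).2, hleaf rfl⟩
    · obtain ⟨σ, hσ, h, ha, hbody⟩ := hinner hn
      have hlen : σ.body.length = n := by simpa using (congrArg List.length hbody).symm
      rw [LTree.support_node a c hn]
      refine ⟨?_, Set.iUnion_subset fun i => (ih i (hc i)).2⟩
      have hroot : ∀ i : Fin σ.body.length, (c (i.cast hlen)).root = (σ.body.get i).map h := by
        intro i
        have := congrArg (fun l => l[(i : ℕ)]?) hbody
        simp only [List.getElem?_ofFn, List.getElem?_map] at this
        rw [dif_pos (by omega)] at this
        simpa [Atom.map, Atom.ground, Fin.cast] using this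
      have := Derives.node σ hσ h (fun i => (c (i.cast hlen)).support) fun i => by
        rw [← hroot]
        exact (ih _ (hc _)).1
      rw [LTree.root, ha]
      exact (finCongr hlen).surjective.iUnion_comp (fun i => (c i).support) ▸ this

theorem Derives.exists_tree {D : Database ar} {Sg : Program ar} (hD : D.Over Sg.edb)
    {α : Fact ar} {S : Set (Fact ar)} (h : Derives Sg α S) (hS : S ⊆ D) :
    ∃ T : LTree (Fact ar), T.IsProofTree D Sg ∧ T.root = α ∧ T.support = S := by
  induction h with
  | leaf α hα =>
    have hα' : α ∈ D := hS rfl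
    refine ⟨.node α 0 Fin.elim0, ?_, rfl, by rw [LTree.support]⟩
    rw [LTree.IsProofTree]
    exact ⟨⟨(hD α hα').1, fun i => ⟨α, hα', i, rfl⟩⟩, fun _ => hα', fun h => absurd rfl h,
      fun i => i.elim0⟩
  | node σ hσ h S _ ih =>
    choose T hT hroot hsupp using fun i => ih i ((Set.subset_iUnion S i).trans hS)
    have hn : σ.body.length ≠ 0 := (List.length_pos_of_ne_nil σ.body_ne_nil).ne'
    refine ⟨.node (σ.head.map h) _ T, ?_, rfl, by simp only [LTree.support_node _ _ hn, hsupp]⟩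
    rw [LTree.IsProofTree]
    refine ⟨⟨⟨σ, hσ, Or.inl rfl⟩, fun i => ?_⟩, fun h => absurd h hn,
      fun _ => ⟨σ, hσ, h, rfl, ?_⟩, hT⟩
    · obtain ⟨b, hb, j, hj⟩ := σ.safe i
      obtain ⟨m, rfl⟩ := List.get_of_mem hb
      have := (hT m).root_mem
      rw [hroot] at this
      have := this.2 j
      change h (σ.head.args i) ∈ _
      rwa [← hj]
    · simp only [hroot]
      refine List.ext_getElem (by simp) fun i _ _ => ?_
      simp [Atom.map, Atom.ground]

/-- The why-provenance in terms of derivations. -/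
theorem Query.mem_why_iff {Q : Query ar} {D : Database ar} (hD : D.Over Q.prog.edb)
    {t : Fin (ar Q.ans) → Const} {S : Set (Fact ar)} :
    S ∈ Q.why D t ↔ Derives Q.prog ⟨Q.ans, t⟩ S ∧ S ⊆ D := by
  constructor
  · rintro ⟨T, hT, hroot, rfl⟩
    rw [← hroot]
    exact hT.derives hD
  · rintro ⟨h, hS⟩
    exact h.exists_tree hD hS

theorem Program.NonRecursive.wellFounded [Finite P] {Sg : Program ar} (h : Sg.NonRecursive) :
    WellFounded Sg.Edge := by
  have : IsTrans P (Relation.TransGen Sg.Edge) := inferInstance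
  have : Std.Irrefl (Relation.TransGen Sg.Edge) := ⟨h⟩
  exact Subrelation.wf Relation.TransGen.single
    (Finite.wellFounded_of_trans_of_irrefl (Relation.TransGen Sg.Edge))

/-- In a non-recursive program, the size of the supports is bounded by a constant. -/
theorem Derives.exists_encard_le [Finite P] {Sg : Program ar} (hSg : Sg.NonRecursive) (p : P) :
    ∃ B : ℕ, ∀ (C : Type) (α : Atom ar C) (S : Set (Atom ar C)), Derives Sg α S → α.pred = p →
      S.encard ≤ B := by
  induction p using hSg.wellFounded.induction with
  | _ p ih =>
    have ih' : ∀ r, ∃ B : ℕ, Sg.Edge r p → ∀ (C : Type) (α : Atom ar C) (S : Set (Atom ar C)),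
        Derives Sg α S → α.pred = r → S.encard ≤ B := by
      intro r
      by_cases hr : Sg.Edge r p
      · exact (ih r hr).imp fun B hB _ => hB
      · exact ⟨0, fun h => absurd h hr⟩
    choose b hb using ih'
    refine ⟨1 + ∑ σ ∈ Sg, ∑ i : Fin σ.body.length, b (σ.body.get i).pred, fun C α S h hp => ?_⟩
    cases h with
    | leaf α hα =>
      rw [Set.encard_singleton]
      exact_mod_cast Nat.le_add_right _ _
    | node σ hσ h S hS =>
      have h₁ : (⋃ i, S i).encard ≤
          ((∑ i : Fin σ.body.length, b (σ.body.get i).pred : ℕ) : ℕ∞) := by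
        refine (Set.encard_iUnion_le_of_fintype _).trans ?_
        push_cast
        exact Finset.sum_le_sum fun i _ =>
          hb _ ⟨σ, hσ, hp, _, List.get_mem _ _, rfl⟩ _ _ _ (hS i) rfl
      refine h₁.trans ?_
      have h₂ := Finset.single_le_sum
        (f := fun σ : Rule ar => ∑ i : Fin σ.body.length, b (σ.body.get i).pred)
        (fun _ _ => Nat.zero_le _) hσ
      exact_mod_cast h₂.trans (Nat.le_add_left _ _)

/-- All supports of facts with the predicate `p` have an enumeration, with repetitions, of the same
length. -/
theorem Derives.exists_range_eq [Finite P] {Sg : Program ar} (hSg : Sg.NonRecursive) (p : P) :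
    ∃ B : ℕ, ∀ (C : Type) (α : Atom ar C) (S : Set (Atom ar C)), Derives Sg α S → α.pred = p →
      ∃ y : Fin B → Atom ar C, Set.range y = S := by
  obtain ⟨B, hB⟩ := Derives.exists_encard_le hSg p
  refine ⟨B, fun C α S h hp => ?_⟩
  have hcard := hB C α S h hp
  have hfin : S.Finite := Set.finite_of_encard_le_coe hcard
  have := hfin.to_subtype
  have := h.nonempty.to_subtype
  rw [Set.encard_le_coe_iff] at hcard
  obtain ⟨-, n, hn, hnB⟩ := hcard
  have hc : Nat.card S ≤ B := by
    rw [Nat.card_coe_set_eq, Set.ncard, hn]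
    simpa using hnB
  let f : S ↪ Fin B := (Finite.equivFin S).toEmbedding.trans (Fin.castLEEmb hc)
  refine ⟨Subtype.val ∘ Function.invFun f, ?_⟩
  rw [(Function.invFun_surjective f.injective).range_comp Subtype.val,
    Subtype.range_coe]

theorem Rule.exists_var_le (σ : Rule ar) :
    ∃ M, ∀ b ∈ σ.head :: σ.body, ∀ i, b.args i ≤ M := by
  have hfin : (⋃ b ∈ {b | b ∈ σ.head :: σ.body}, Set.range b.args).Finite :=
    (List.finite_toSet _).biUnion fun b _ => Set.finite_range _
  exact hfin.bddAbove.imp fun M hM b hb i => hM (Set.mem_biUnion hb ⟨i, rfl⟩)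

section

variable {α : Type}

theorem bitDef_atom_eq (p q : P) (a : Fin (ar p) → α) (b : Fin (ar q) → α) :
    BitDef fun w v => (⟨p, fun i => v (a i)⟩ : Atom ar (Fin (w.length + 1))) =
      ⟨q, fun i => v (b i)⟩ := by
  by_cases h : p = q
  · subst h
    refine (UDef.finite_forall fun i => UDef.eq (a i) (b i)).congr fun w v => ?_
    simp [funext_iff]
  · refine (UDef.const False).congr fun w v => ?_
    simp [h]

/-- The derivations with support `y '' J`, unfolded once. The support of a rule instance is split by
splitting the index set. Since the variables of `σ` are at most `M σ`, an assignment of finitely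
many variables suffices; it is extended to all variables by taking remainders. -/
theorem derives_image_iff {Sg : Program ar} {C κ : Type} [Fintype κ] [DecidableEq κ] (p : P)
    (a : Fin (ar p) → C) (y : κ → Atom ar C) (J : Finset κ) (M : Rule ar → ℕ)
    (hM : ∀ σ : Rule ar, ∀ b ∈ σ.head :: σ.body, ∀ i, b.args i ≤ M σ) :
    Derives Sg ⟨p, a⟩ (y '' J) ↔
      (p ∉ Sg.idb ∧ J.Nonempty ∧ ∀ j, j ∈ J → y j = ⟨p, a⟩) ∨
      ∃ σ : {σ // σ ∈ Sg}, σ.1.head.pred = p ∧ ∃ K : Fin σ.1.body.length → Finset κ,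
        Finset.univ.biUnion K = J ∧ ∃ h : Fin (M σ + 1) → C,
          σ.1.head.map (fun x => h (Fin.ofNat _ x)) = ⟨p, a⟩ ∧
          ∀ i, Derives Sg ((σ.1.body.get i).map fun x => h (Fin.ofNat _ x)) (y '' K i) := by
  constructor
  · intro hd
    generalize hα : (⟨p, a⟩ : Atom ar C) = α at hd
    generalize hS : y '' J = S at hd
    cases hd with
    | leaf _ hp =>
      subst hα
      refine Or.inl ⟨hp, ?_, fun j hj => ?_⟩
      · have : (y '' J).Nonempty := hS ▸ Set.singleton_nonempty _
        exact_mod_cast this.of_image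
      · have : y j ∈ y '' (J : Set κ) := ⟨j, hj, rfl⟩
        rw [hS] at this
        exact this
    | node σ hσ h S' hS' =>
      classical
      refine Or.inr ⟨⟨σ, hσ⟩, (congrArg Atom.pred hα).symm, fun i => J.filter fun j => y j ∈ S' i,
        ?_, fun x => h x, ?_, fun i => ?_⟩
      · ext j
        simp only [Finset.mem_biUnion, Finset.mem_univ, true_and, Finset.mem_filter]
        refine ⟨fun ⟨_, hj, _⟩ => hj, fun hj => ?_⟩
        have : y j ∈ y '' (J : Set κ) := ⟨j, hj, rfl⟩
        rw [hS] at this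
        exact (Set.mem_iUnion.1 this).imp fun i hi => ⟨hj, hi⟩
      · simp only [Atom.map]
        congr! 3 with i
        exact Nat.mod_eq_of_lt (Nat.lt_succ_of_le (hM σ _ List.mem_cons_self i))
      · have hi : (y '' (J.filter fun j => y j ∈ S' i : Finset κ)) = S' i := by
          refine Set.Subset.antisymm ?_ fun β hβ => ?_
          · rintro _ ⟨j, hj, rfl⟩
            exact (Finset.mem_filter.1 hj).2
          · have : β ∈ y '' (J : Set κ) := hS ▸ Set.mem_iUnion.2 ⟨i, hβ⟩
            obtain ⟨j, hj, rfl⟩ := this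
            exact ⟨j, Finset.mem_filter.2 ⟨hj, hβ⟩, rfl⟩
        rw [hi]
        convert hS' i using 1
        simp only [Atom.map]
        congr! 3 with j
        exact Nat.mod_eq_of_lt (Nat.lt_succ_of_le
          (hM σ _ (List.mem_cons_of_mem _ (List.get_mem _ _)) j))
  · rintro (⟨hp, hJ, hy⟩ | ⟨σ, -, K, rfl, h, hhead, hbody⟩)
    · have : y '' J = {⟨p, a⟩} := by
        refine Set.Subset.antisymm ?_ ?_
        · rintro _ ⟨j, hj, rfl⟩
          exact hy j hj
        · obtain ⟨j, hj⟩ := hJ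
          rintro _ rfl
          exact ⟨j, hj, hy j hj⟩
      rw [this]
      exact .leaf _ hp
    · have := Derives.node σ.1 σ.2 _ _ hbody
      rw [hhead, ← Set.image_iUnion] at this
      convert this using 2
      simp

/-- For a non-recursive program and facts `y j` with given predicates, it is definable that a fact
has a derivation whose support is the set of the facts `y j` with `j ∈ J`. -/
theorem bitDef_derives [Finite P] {Sg : Program ar} (hSg : Sg.NonRecursive) {κ : Type} [Fintype κ]
    [DecidableEq κ] (q : κ → P) (p : P) (J : Finset κ) {α : Type} (a : Fin (ar p) → α)
    (y : ∀ j, Fin (ar (q j)) → α) :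
    BitDef fun w v => Derives Sg (⟨p, fun i => v (a i)⟩ : Atom ar (Fin (w.length + 1)))
      ((fun j => ⟨q j, fun i => v (y j i)⟩) '' J) := by
  induction p using hSg.wellFounded.induction generalizing J α with
  | _ p ih =>
    choose M hM using Rule.exists_var_le (ar := ar)
    refine UDef.congr ?_ fun w v => derives_image_iff p _ _ J M hM
    refine UDef.or (UDef.const_and fun _ => UDef.const_and fun _ => UDef.finite_forall fun j =>
      UDef.const_imp fun _ => bitDef_atom_eq _ _ _ _) ?_
    refine UDef.finite_exists fun σ => UDef.const_and fun hσ => UDef.finite_exists fun K =>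
      UDef.const_and fun _ => UDef.exists_tuple (UDef.and ?_ (UDef.finite_forall fun i => ?_))
    · exact bitDef_atom_eq _ _ (fun i => Sum.inr (Fin.ofNat _ (σ.1.head.args i)))
        (fun i => Sum.inl (a i))
    · exact ih _ ⟨σ.1, σ.2, hσ, _, List.get_mem _ _, rfl⟩ (K i)
        (fun j => Sum.inr (Fin.ofNat _ ((σ.1.body.get i).args j))) (fun j l => Sum.inl (y j l))

end

end Derivations

/-! ### Positions in the encoding -/

section Positions

theorem eq_of_bits {w w' : List Bool} (hl : w.length = w'.length)
    (h : ∀ i < w.length, (w[i]? = some true ↔ w'[i]? = some true)) : w = w' := by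
  refine List.ext_getElem hl fun i h₁ h₂ => ?_
  have := h i h₁
  rw [List.getElem?_eq_getElem h₁, List.getElem?_eq_getElem h₂] at this
  simpa using Bool.eq_iff_iff.2 (by simpa using this)

theorem getElem?_flatMap {ι β : Type*} (l : List ι) (g : ι → List β) {s : ℕ} (hs : s < l.length)
    {j : ℕ} (hj : j < (g l[s]).length) :
    (l.flatMap g)[((l.take s).map fun c => (g c).length).sum + j]? = (g l[s])[j]? := by
  induction l generalizing s with
  | nil => simp at hs
  | cons c l ih =>
    cases s with
    | zero =>
      simp only [List.getElem_cons_zero] at hj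
      simp [List.flatMap_cons, List.getElem?_append_left hj]
    | succ s =>
      simp only [List.length_cons, Nat.add_lt_add_iff_right] at hs
      simp only [List.getElem_cons_succ] at hj ⊢
      rw [List.flatMap_cons, List.take_succ_cons, List.map_cons, List.sum_cons, add_assoc,
        List.getElem?_append_right (Nat.le_add_right _ _), Nat.add_sub_cancel_left, ih hs hj]

theorem exists_flatMap_position {ι : Type*} (l : List ι) (len : ι → ℕ) {i : ℕ}
    (hi : i < (l.map len).sum) : ∃ (s : ℕ) (hs : s < l.length), ∃ j < len l[s],
      i = ((l.take s).map len).sum + j := by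
  induction l generalizing i with
  | nil => simp at hi
  | cons c l ih =>
    by_cases h : i < len c
    · exact ⟨0, by simp, i, h, by simp⟩
    · rw [List.map_cons, List.sum_cons] at hi
      obtain ⟨s, hs, j, hj, hij⟩ := ih (i := i - len c) (by omega)
      refine ⟨s + 1, by simpa using hs, j, by simpa using hj, ?_⟩
      rw [List.take_succ_cons, List.map_cons, List.sum_cons]
      omega

/-- The position of a tuple in the table of a relation over `n` elements. -/
def tuplePos (n : ℕ) {r : ℕ} (a : Fin r → ℕ) : ℕ := ∑ i, a i * n ^ (i : ℕ)

theorem tuplePos_eq {n r : ℕ} (a : Fin r → Fin n) :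
    tuplePos n (fun i => (a i : ℕ)) = finFunctionFinEquiv a :=
  (finFunctionFinEquiv_apply a).symm

variable {P : Type*} {ar : P → ℕ}

theorem length_relBits (D : Database ar) {n : ℕ} (e : Fin n → Const) (p : P) :
    (relBits D e p).length = n ^ ar p := by
  simp [relBits]

theorem bit_relBits (D : Database ar) {n : ℕ} (e : Fin n → Const) (p : P) (a : Fin (ar p) → Fin n) :
    (relBits D e p)[tuplePos n fun i => (a i : ℕ)]? = some true ↔ (⟨p, e ∘ a⟩ : Fact ar) ∈ D := by
  rw [relBits, List.getElem?_ofFn, tuplePos_eq, dif_pos (Fin.is_lt _)]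
  simp [Function.comp_def]

/-- The length of the tables of all relations in the list `l`. -/
def tablesLength (ar : P → ℕ) (l : List P) (n : ℕ) : ℕ := (l.map fun p => n ^ ar p).sum

theorem length_flatMap_relBits (l : List P) (D : Database ar) {n : ℕ} (e : Fin n → Const) :
    (l.flatMap (relBits D e)).length = tablesLength ar l n := by
  simp [List.length_flatMap, length_relBits, tablesLength]

variable [LinearOrder P]

/-- The position of the fact `p(a)` in the tables of the relations in the list `l`. -/
def factPos (l : List P) (n : ℕ) (p : P) (a : Fin (ar p) → ℕ) : ℕ :=
  tablesLength ar (l.take (l.idxOf p)) n + tuplePos n a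

theorem bit_flatMap_relBits {l : List P} (D : Database ar) {n : ℕ} (e : Fin n → Const) {p : P}
    (hp : p ∈ l) (a : Fin (ar p) → Fin n) :
    (l.flatMap (relBits D e))[factPos l n p fun i => (a i : ℕ)]? = some true ↔
      (⟨p, e ∘ a⟩ : Fact ar) ∈ D := by
  have hs := List.idxOf_lt_length_of_mem hp
  have hl : l[l.idxOf p] = p := List.getElem_idxOf hs
  have := getElem?_flatMap l (relBits D e) hs (j := tuplePos n fun i => (a i : ℕ))
    (by rw [hl, length_relBits, tuplePos_eq]; exact Fin.is_lt _)
  simp only [length_relBits] at this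
  rw [factPos, tablesLength, this, hl, bit_relBits]

theorem exists_factPos {l : List P} (hl : l.Nodup) {n i : ℕ} (hi : i < tablesLength ar l n) :
    ∃ p ∈ l, ∃ a : Fin (ar p) → Fin n, i = factPos l n p fun i => (a i : ℕ) := by
  obtain ⟨s, hs, j, hj, rfl⟩ := exists_flatMap_position l _ hi
  refine ⟨l[s], List.getElem_mem hs, finFunctionFinEquiv.symm ⟨j, hj⟩, ?_⟩
  rw [factPos, tuplePos_eq, Equiv.apply_symm_apply, hl.idxOf_getElem, tablesLength]

theorem length_flatMap_constBits {r n : ℕ} (e : Fin n → Const) (t : Fin r → Const) :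
    ((List.ofFn t).flatMap (constBits e)).length = r * n := by
  simp [List.length_flatMap, constBits, Function.comp_def, List.ofFn_const]

theorem bit_flatMap_constBits {r n : ℕ} (e : Fin n → Const) (t : Fin r → Const) (i : Fin r)
    (c : Fin n) :
    ((List.ofFn t).flatMap (constBits e))[(i * n + c : ℕ)]? = some true ↔ e c = t i := by
  have := getElem?_flatMap (List.ofFn t) (constBits e) (s := i) (by simp) (j := c)
    (by simp [constBits])
  simp only [constBits, List.length_ofFn, List.map_const', List.sum_replicate, List.length_take,
    smul_eq_mul, min_eq_left i.2.le] at this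
  rw [this]
  simp

theorem getElem?_append_append {β : Type*} (h a b d : List β) (i : ℕ) :
    (i < h.length → (h ++ a ++ b ++ d)[i]? = h[i]?) ∧
    (i < a.length → (h ++ a ++ b ++ d)[h.length + i]? = a[i]?) ∧
    (i < b.length → (h ++ a ++ b ++ d)[h.length + a.length + i]? = b[i]?) ∧
    (h ++ a ++ b ++ d)[h.length + a.length + b.length + i]? = d[i]? := by
  refine ⟨fun hi => ?_, fun hi => ?_, fun hi => ?_, ?_⟩
  · rw [List.append_assoc, List.append_assoc, List.getElem?_append_left hi]
  · rw [List.append_assoc, List.append_assoc, List.getElem?_append_right (Nat.le_add_right _ _),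
      Nat.add_sub_cancel_left, List.getElem?_append_left hi]
  · rw [List.append_assoc, ← List.length_append, List.getElem?_append_right (Nat.le_add_right _ _),
      Nat.add_sub_cancel_left, List.getElem?_append_left hi]
  · rw [← List.length_append, ← List.length_append,
      List.getElem?_append_right (Nat.le_add_right _ _), Nat.add_sub_cancel_left]

theorem Program.nodup_edbList [Fintype P] (Sg : Program ar) : Sg.edbList.Nodup :=
  Finset.sort_nodup _ _

theorem Program.mem_edbList [Fintype P] {Sg : Program ar} {p : P} :
    p ∈ Sg.edbList ↔ p ∈ Sg.edb := by
  simp [Program.edbList]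

/-- The bit string `w` has the form of an encoding of a structure with `n` elements, in which the
tables of the two databases and of the tuple are as described by `A`, `B` and `C`. -/
structure HasTables (ar : P → ℕ) (l : List P) (r n : ℕ) (A B : ∀ p, (Fin (ar p) → Fin n) → Prop)
    (C : Fin r → Fin n → Prop) (w : List Bool) : Prop where
  length : w.length = n + 1 + tablesLength ar l n + tablesLength ar l n + r * n
  zeros : ∀ i < n, w[i]? ≠ some true
  one : w[n]? = some true
  fst : ∀ p ∈ l, ∀ a : Fin (ar p) → Fin n,
    w[n + 1 + factPos l n p fun i => (a i : ℕ)]? = some true ↔ A p a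
  snd : ∀ p ∈ l, ∀ a : Fin (ar p) → Fin n,
    w[n + 1 + tablesLength ar l n + factPos l n p fun i => (a i : ℕ)]? = some true ↔ B p a
  tuple : ∀ (i : Fin r) (c : Fin n),
    w[n + 1 + tablesLength ar l n + tablesLength ar l n + (i * n + c)]? = some true ↔ C i c

theorem HasTables.unique {l : List P} (hl : l.Nodup) {r n : ℕ}
    {A B : ∀ p, (Fin (ar p) → Fin n) → Prop} {C : Fin r → Fin n → Prop} {w w' : List Bool}
    (h : HasTables ar l r n A B C w) (h' : HasTables ar l r n A B C w') : w = w' := by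
  refine eq_of_bits (h.length.trans h'.length.symm) fun i hi => ?_
  rw [h.length] at hi
  rcases lt_or_ge i n with h₁ | h₁
  · exact iff_of_false (h.zeros i h₁) (h'.zeros i h₁)
  rcases eq_or_lt_of_le h₁ with rfl | h₁
  · exact iff_of_true h.one h'.one
  obtain ⟨i, rfl⟩ := Nat.exists_eq_add_of_le (Nat.succ_le_of_lt h₁)
  rw [Nat.succ_eq_add_one] at hi ⊢
  rcases lt_or_ge i (tablesLength ar l n) with h₂ | h₂
  · obtain ⟨p, hp, a, rfl⟩ := exists_factPos hl h₂
    exact (h.fst p hp a).trans (h'.fst p hp a).symm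
  obtain ⟨i, rfl⟩ := Nat.exists_eq_add_of_le h₂
  rw [← add_assoc] at hi ⊢
  rcases lt_or_ge i (tablesLength ar l n) with h₃ | h₃
  · obtain ⟨p, hp, a, rfl⟩ := exists_factPos hl h₃
    exact (h.snd p hp a).trans (h'.snd p hp a).symm
  obtain ⟨i, rfl⟩ := Nat.exists_eq_add_of_le h₃
  rw [← add_assoc] at hi ⊢
  have hi : i < r * n := by omega
  have hn : 0 < n := Nat.pos_of_ne_zero (by rintro rfl; simp at hi)
  have := (h.tuple ⟨i / n, Nat.div_lt_of_lt_mul (by rwa [mul_comm])⟩ ⟨i % n, Nat.mod_lt _ hn⟩).trans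
    (h'.tuple _ _).symm
  simpa only [Nat.div_add_mod'] using this

variable [Fintype P]

theorem Instance.hasTables_encode {Q : Query ar} (I : Instance Q) {n : ℕ} (e : Fin n → Const) :
    HasTables ar Q.prog.edbList (ar Q.ans) n (fun p a => (⟨p, e ∘ a⟩ : Fact ar) ∈ I.D)
      (fun p a => (⟨p, e ∘ a⟩ : Fact ar) ∈ I.D') (fun i c => e c = I.t i) (I.encode e) := by
  have hpos : ∀ p ∈ Q.prog.edbList, ∀ a : Fin (ar p) → Fin n,
      factPos Q.prog.edbList n p (fun i => (a i : ℕ)) < tablesLength ar Q.prog.edbList n := by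
    intro p hp a
    by_contra hlt
    -- In the tables of the database that consists of the fact itself, its bit is set.
    have := (bit_flatMap_relBits {(⟨p, e ∘ a⟩ : Fact ar)} e hp a).2 (Finset.mem_singleton_self _)
    rw [List.getElem?_eq_none (by rw [length_flatMap_relBits]; omega)] at this
    cases this
  have hh : (List.replicate n false ++ [true]).length = n + 1 := by simp
  have key := fun i => getElem?_append_append (List.replicate n false ++ [true])
    (Q.prog.edbList.flatMap (relBits I.D e)) (Q.prog.edbList.flatMap (relBits I.D' e))
    ((List.ofFn I.t).flatMap (constBits e)) i
  rw [hh, length_flatMap_relBits, length_flatMap_relBits] at key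
  constructor
  · simp only [Instance.encode, List.length_append, length_flatMap_relBits,
      length_flatMap_constBits, List.length_replicate, List.length_singleton]
  · intro i hi
    rw [Instance.encode, (key i).1 (by omega), List.getElem?_append_left (by simpa using hi)]
    simp [hi]
  · rw [Instance.encode, (key n).1 (by omega), List.getElem?_append_right (by simp)]
    simp
  · intro p hp a
    rw [Instance.encode, (key _).2.1 (hpos p hp a), bit_flatMap_relBits _ _ hp]
  · intro p hp a
    rw [Instance.encode, (key _).2.2.1 (hpos p hp a), bit_flatMap_relBits _ _ hp]
  · intro i c
    rw [Instance.encode, (key _).2.2.2, bit_flatMap_constBits]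

end Positions

/-! ### The defining sentence -/

section Sentence

variable {P : Type*} {ar : P → ℕ} {α : Type}

theorem natDef_tablesLength (l : List P) (x : α) : NatDef fun _ v => tablesLength ar l (v x) :=
  NatDef.list_sum l fun p => (NatDef.var x).pow (ar p)

/-- A support of bounded size can be guessed. -/
theorem derives_iff_exists_enumeration {Sg : Program ar} {p : P} {B : ℕ}
    (hB : ∀ (C : Type) (α : Atom ar C) (S : Set (Atom ar C)), Derives Sg α S → α.pred = p →
      ∃ y : Fin B → Atom ar C, Set.range y = S)
    {C : Type} (t : Fin (ar p) → C) (S : Set (Atom ar C)) :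
    Derives Sg ⟨p, t⟩ S ↔ ∃ q : Fin B → P, ∃ y : (Σ j, Fin (ar (q j))) → C,
      Derives Sg ⟨p, t⟩ ((fun j => (⟨q j, fun i => y ⟨j, i⟩⟩ : Atom ar C)) ''
        ((Finset.univ : Finset (Fin B)) : Set (Fin B))) ∧
      ∀ r, ∀ a : Fin (ar r) → C,
        ((⟨r, a⟩ : Atom ar C) ∈ S ↔ ∃ j, (⟨q j, fun i => y ⟨j, i⟩⟩ : Atom ar C) = ⟨r, a⟩) := by
  constructor
  · intro h
    obtain ⟨y, rfl⟩ := hB C _ S h rfl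
    refine ⟨fun j => (y j).pred, fun x => (y x.1).args x.2, ?_, fun r a => Iff.rfl⟩
    rwa [Finset.coe_univ, Set.image_univ]
  · rintro ⟨q, y, h, hS⟩
    rw [Finset.coe_univ, Set.image_univ] at h
    convert h using 1
    ext ⟨r, a⟩
    exact hS r a

theorem exists_castLE {r n N : ℕ} (h : n ≤ N) {a : Fin r → Fin N} (ha : ∀ i, (a i : ℕ) < n) :
    ∃ a' : Fin r → Fin n, a = fun i => (a' i).castLE h :=
  ⟨fun i => ⟨a i, ha i⟩, rfl⟩

variable [LinearOrder P]

theorem natDef_factPos (l : List P) (x : α) (p : P) (a : Fin (ar p) → α) :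
    NatDef fun _ v => factPos l (v x) p fun i => (v (a i) : ℕ) :=
  (natDef_tablesLength _ x).add <| NatDef.finset_sum _ fun i =>
    (NatDef.var (a i)).mul ((NatDef.var x).pow i)

variable [Fintype P]

/-- The position of the bit of the fact `p(a)` in the table of the first database. -/
def fstPos (Sg : Program ar) (n : ℕ) (p : P) (a : Fin (ar p) → ℕ) : ℕ :=
  n + 1 + factPos Sg.edbList n p a

/-- The position of the bit of the fact `p(a)` in the table of the second database. -/
def sndPos (Sg : Program ar) (n : ℕ) (p : P) (a : Fin (ar p) → ℕ) : ℕ :=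
  n + 1 + tablesLength ar Sg.edbList n + factPos Sg.edbList n p a

/-- The position of the bit that tells whether the component `i` of the tuple is the element `c`. -/
def tupleBitPos (Sg : Program ar) (n i c : ℕ) : ℕ :=
  n + 1 + tablesLength ar Sg.edbList n + tablesLength ar Sg.edbList n + (i * n + c)

theorem natDef_fstPos (Sg : Program ar) (x : α) (p : P) (a : Fin (ar p) → α) :
    NatDef fun _ v => fstPos Sg (v x) p fun i => (v (a i) : ℕ) :=
  ((NatDef.var x).add .one).add (natDef_factPos _ x p a)

theorem natDef_sndPos (Sg : Program ar) (x : α) (p : P) (a : Fin (ar p) → α) :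
    NatDef fun _ v => sndPos Sg (v x) p fun i => (v (a i) : ℕ) :=
  (((NatDef.var x).add .one).add (natDef_tablesLength _ x)).add (natDef_factPos _ x p a)

theorem natDef_tupleBitPos (Sg : Program ar) (x : α) (i : ℕ) (c : α) :
    NatDef fun _ v => tupleBitPos Sg (v x) i (v c) :=
  ((((NatDef.var x).add .one).add (natDef_tablesLength _ x)).add (natDef_tablesLength _ x)).add <|
    ((NatDef.natConst i).mul (NatDef.var x)).add (NatDef.var c)

/-- The facts of the second database, over the numbers up to the length of `w`. -/
def sndFacts (Sg : Program ar) (w : List Bool) (n : ℕ) : Set (Atom ar (Fin (w.length + 1))) :=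
  {β | β.pred ∈ Sg.edbList ∧ (∀ i, (β.args i : ℕ) < n) ∧
    w[sndPos Sg n β.pred fun i => (β.args i : ℕ)]? = some true}

/-- The bit string `w` encodes an instance with `n` elements whose second database is the support of
a derivation of the tuple. The conditions are, in this order: the length; the prefix `0ⁿ1`; every
element occurs in the first database; the second database is contained in the first; the components
of the tuple are elements; and the derivation. -/
def EncodesWhy (Q : Query ar) (w : List Bool) (n : Fin (w.length + 1)) : Prop :=
  w.length = n + 1 + tablesLength ar Q.prog.edbList n + tablesLength ar Q.prog.edbList n +
    ar Q.ans * n ∧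
  (∀ i, i < n → ¬ w[(i : ℕ)]? = some true) ∧
  w[(n : ℕ)]? = some true ∧
  (∀ c, c < n → ∃ p, p ∈ Q.prog.edbList ∧ ∃ a : Fin (ar p) → Fin (w.length + 1),
    (∀ i, a i < n) ∧ (∃ i, a i = c) ∧ w[fstPos Q.prog n p fun i => (a i : ℕ)]? = some true) ∧
  (∀ p, p ∈ Q.prog.edbList → ∀ a : Fin (ar p) → Fin (w.length + 1), (∀ i, a i < n) →
    w[sndPos Q.prog n p fun i => (a i : ℕ)]? = some true →
      w[fstPos Q.prog n p fun i => (a i : ℕ)]? = some true) ∧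
  ∃ t : Fin (ar Q.ans) → Fin (w.length + 1), (∀ i, t i < n) ∧
    (∀ i : Fin (ar Q.ans), ∀ c, c < n → (w[tupleBitPos Q.prog n i c]? = some true ↔ c = t i)) ∧
    Derives Q.prog ⟨Q.ans, t⟩ (sndFacts Q.prog w n)

theorem bitDef_encodesWhy {Q : Query ar} (hQ : Q.NonRecursive) :
    BitDef fun w (_ : Empty → _) => ∃ n, EncodesWhy Q w n := by
  obtain ⟨B, hB⟩ := Derives.exists_range_eq hQ Q.ans
  refine UDef.exists_elem ?_
  have hlt : ∀ {β : Type} {r : ℕ} (a : Fin r → β) (x : β),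
      BitDef fun w v => ∀ i, v (a i) < v x :=
    fun a x => UDef.finite_forall fun i => bitDef_lt _ _
  refine UDef.and ?_ <| UDef.and ?_ <| UDef.and ?_ <| UDef.and ?_ <| UDef.and ?_ <|
    UDef.exists_tuple <| UDef.and ?_ <| UDef.and ?_ ?_
  · exact NatDef.length_eq <| ((((NatDef.var _).add .one).add (natDef_tablesLength _ _)).add
      (natDef_tablesLength _ _)).add <| (NatDef.natConst _).mul (NatDef.var (Sum.inr ()))
  · exact UDef.forall_elem <| (bitDef_lt (Sum.inr ()) (Sum.inl (Sum.inr ()))).imp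
      (bitDef_bit (Sum.inr ())).not
  · exact bitDef_bit (Sum.inr ())
  · refine UDef.forall_elem <| UDef.imp (bitDef_lt (Sum.inr ()) (Sum.inl (Sum.inr ()))) <|
      UDef.finite_exists fun p => UDef.const_and fun _ => UDef.exists_tuple <|
      (hlt Sum.inr (Sum.inl (Sum.inl (Sum.inr ())))).and <|
      (UDef.finite_exists fun i => UDef.eq (Sum.inr i) (Sum.inl (Sum.inr ()))).and ?_
    exact (natDef_fstPos Q.prog (Sum.inl (Sum.inl (Sum.inr ()))) p Sum.inr).bit
  · refine UDef.finite_forall fun p => UDef.const_imp fun _ => UDef.forall_tuple <|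
      (hlt Sum.inr (Sum.inl (Sum.inr ()))).imp <| UDef.imp ?_ ?_
    · exact (natDef_sndPos Q.prog (Sum.inl (Sum.inr ())) p Sum.inr).bit
    · exact (natDef_fstPos Q.prog (Sum.inl (Sum.inr ())) p Sum.inr).bit
  · exact hlt Sum.inr (Sum.inl (Sum.inr ()))
  · refine UDef.finite_forall fun i => UDef.forall_elem <|
      (bitDef_lt (Sum.inr ()) (Sum.inl (Sum.inl (Sum.inr ())))).imp <| UDef.iff ?_ <|
      UDef.eq (Sum.inr ()) (Sum.inl (Sum.inr i))
    exact (natDef_tupleBitPos Q.prog (Sum.inl (Sum.inl (Sum.inr ()))) i (Sum.inr ())).bit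
  · refine UDef.congr ?_ fun w v => derives_iff_exists_enumeration hB _ _
    refine UDef.finite_exists fun q => UDef.exists_tuple <| UDef.and ?_ <|
      UDef.finite_forall fun p => UDef.forall_tuple <| UDef.iff ?_ <|
      UDef.finite_exists fun j => ?_
    · exact bitDef_derives hQ q Q.ans Finset.univ (fun i => Sum.inl (Sum.inr i))
        fun j i => Sum.inr (⟨j, i⟩ : Σ j, Fin (ar (q j)))
    · refine UDef.const_and (p := p ∈ Q.prog.edbList) fun _ =>
        (hlt Sum.inr (Sum.inl (Sum.inl (Sum.inl (Sum.inr ()))))).and ?_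
      exact (natDef_sndPos Q.prog (Sum.inl (Sum.inl (Sum.inl (Sum.inr ())))) p Sum.inr).bit
    · exact bitDef_atom_eq (q j) p (fun i => Sum.inl (Sum.inr (⟨j, i⟩ : Σ j, Fin (ar (q j)))))
        Sum.inr

/-- The database over the numbers below `n` with the facts that satisfy `A`. -/
def databaseOf (Sg : Program ar) (n : ℕ) (A : ∀ p, (Fin (ar p) → ℕ) → Prop) : Database ar :=
  (Set.toFinite ((fun x : Σ p, Fin (ar p) → Fin n => (⟨x.1, fun i => x.2 i⟩ : Fact ar)) ''
    {x | x.1 ∈ Sg.edbList ∧ A x.1 fun i => (x.2 i : ℕ)})).toFinset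

theorem mem_databaseOf {Sg : Program ar} {n : ℕ} {A : ∀ p, (Fin (ar p) → ℕ) → Prop} {p : P}
    {a : Fin (ar p) → ℕ} :
    (⟨p, a⟩ : Fact ar) ∈ databaseOf Sg n A ↔ p ∈ Sg.edbList ∧ (∀ i, a i < n) ∧ A p a := by
  rw [databaseOf, Set.Finite.mem_toFinset]
  constructor
  · rintro ⟨⟨q, b⟩, ⟨hq, hA⟩, h⟩
    cases h
    exact ⟨hq, fun i => (b i).2, hA⟩
  · rintro ⟨hp, ha, hA⟩
    exact ⟨⟨p, fun i => ⟨a i, ha i⟩⟩, ⟨hp, hA⟩, rfl⟩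

theorem mem_whyProvenance_of_encodesWhy {Q : Query ar} {w : List Bool} {n : Fin (w.length + 1)}
    (h : EncodesWhy Q w n) : w ∈ whyProvenance Q := by
  obtain ⟨hlen, hzero, hone, hadom, hsub, t, ht, htbit, hder⟩ := h
  have hn : (n : ℕ) ≤ w.length + 1 := n.2.le
  set D := databaseOf Q.prog n fun p a => w[fstPos Q.prog n p a]? = some true
  set D' := databaseOf Q.prog n fun p a => w[sndPos Q.prog n p a]? = some true
  have hadomD : D.adom = {c | c < (n : ℕ)} := by
    ext c
    constructor
    · rintro ⟨⟨p, a⟩, hα, i, rfl⟩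
      exact (mem_databaseOf.1 hα).2.1 i
    · intro hc
      obtain ⟨p, hp, a, ha, ⟨i, hi⟩, hb⟩ := hadom ⟨c, lt_of_lt_of_le hc hn⟩ hc
      exact ⟨⟨p, fun i => a i⟩, mem_databaseOf.2 ⟨hp, ha, hb⟩, i, congrArg Fin.val hi⟩
  have hDsub : D' ⊆ D := by
    rintro ⟨p, a⟩ hα
    obtain ⟨hp, ha, hb⟩ := mem_databaseOf.1 hα
    exact mem_databaseOf.2 ⟨hp, ha, hsub p hp (fun i => ⟨a i, lt_of_lt_of_le (ha i) hn⟩) ha hb⟩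
  let I : Instance Q :=
    { D := D
      isOver := by
        rintro ⟨p, a⟩ hα
        exact Program.mem_edbList.1 (mem_databaseOf.1 hα).1
      t := fun i => t i
      t_mem := fun i => by
        rw [hadomD]
        exact ht i
      D' := D'
      sub := hDsub }
  refine ⟨I, n, Fin.val, Fin.val_injective, ?_, ?_, ?_⟩
  · change _ = D.adom
    rw [hadomD, Fin.range_val]
    rfl
  · rw [Query.mem_why_iff I.isOver]
    refine ⟨?_, Finset.coe_subset.2 hDsub⟩
    suffices hS : (D' : Set (Fact ar)) = Atom.map Fin.val '' sndFacts Q.prog w n by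
      change Derives Q.prog _ (D' : Set (Fact ar))
      rw [hS]
      exact hder.map Fin.val
    ext ⟨p, a⟩
    refine mem_databaseOf.trans ⟨fun ⟨hp, ha, hb⟩ => ?_, ?_⟩
    · exact ⟨⟨p, fun i => ⟨a i, lt_of_lt_of_le (ha i) hn⟩⟩, ⟨hp, ha, hb⟩, rfl⟩
    · rintro ⟨⟨q, b⟩, ⟨hq, hb, hbit⟩, h⟩
      cases h
      exact ⟨hq, hb, hbit⟩
  · refine HasTables.unique Q.prog.nodup_edbList ?_ (I.hasTables_encode Fin.val)
    refine ⟨hlen, fun i hi => hzero ⟨i, hi.trans n.2⟩ hi, hone, fun p hp a => ?_, fun p hp a => ?_,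
      fun i c => ?_⟩
    · exact ((mem_databaseOf (A := fun p a => w[fstPos Q.prog n p a]? = some true)).trans
        ⟨fun h => h.2.2, fun h => ⟨hp, fun i => (a i).2, h⟩⟩).symm
    · exact ((mem_databaseOf (A := fun p a => w[sndPos Q.prog n p a]? = some true)).trans
        ⟨fun h => h.2.2, fun h => ⟨hp, fun i => (a i).2, h⟩⟩).symm
    · exact (htbit i (c.castLE hn) c.2).trans Fin.ext_iff

theorem exists_encodesWhy_of_mem {Q : Query ar} {w : List Bool} (h : w ∈ whyProvenance Q) :
    ∃ n, EncodesWhy Q w n := by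
  obtain ⟨I, n, e, hinj, hrange, hwhy, hw⟩ := h
  have hT := I.hasTables_encode e
  rw [← hw] at hT
  clear hw
  obtain ⟨hder, -⟩ := (Query.mem_why_iff I.isOver).1 hwhy
  have hn : n < w.length + 1 := by
    have := hT.length
    omega
  have hfact : ∀ p (b : Fin (ar p) → Const), (⟨p, b⟩ : Fact ar) ∈ I.D →
      ∃ a : Fin (ar p) → Fin n, e ∘ a = b := by
    intro p b hα
    have : ∀ i, ∃ j, e j = b i := fun i => by
      rw [← Set.mem_range, hrange]
      exact ⟨_, hα, i, rfl⟩
    choose a ha using this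
    exact ⟨a, funext ha⟩
  have hedb : ∀ α ∈ I.D, α.pred ∈ Q.prog.edbList :=
    fun α hα => Program.mem_edbList.2 (I.isOver α hα)
  choose t ht using fun i => (by rw [← Set.mem_range, hrange]; exact I.t_mem i : ∃ j, e j = I.t i)
  -- A left inverse of the enumeration turns constants into numbers.
  obtain ⟨g, hg⟩ : ∃ g : Const → Fin (w.length + 1), ∀ j, g (e j) = j.castLE hn.le :=
    ⟨Function.extend e (Fin.castLE hn.le) fun _ => 0, fun j => hinj.extend_apply _ _ j⟩
  refine ⟨⟨n, hn⟩, hT.length, fun i hi => hT.zeros i hi, hT.one, fun c hc => ?_,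
    fun p hp a ha hb => ?_, fun i => (t i).castLE hn.le, fun i => (t i).2, fun i c hc => ?_, ?_⟩
  · obtain ⟨⟨p, b⟩, hα, i, hi⟩ : e ⟨c, hc⟩ ∈ I.D.adom := hrange ▸ Set.mem_range_self _
    obtain ⟨a, rfl⟩ := hfact p b hα
    refine ⟨p, hedb _ hα, fun i => (a i).castLE hn.le, fun i => (a i).2, ⟨i, ?_⟩, ?_⟩
    · exact congrArg (Fin.castLE hn.le) (hinj hi)
    · exact (hT.fst p (hedb _ hα) a).2 hα
  · obtain ⟨a, rfl⟩ := exists_castLE hn.le ha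
    exact (hT.fst p hp a).2 (I.sub ((hT.snd p hp a).1 hb))
  · refine (hT.tuple i ⟨c, hc⟩).trans ?_
    rw [← ht, hinj.eq_iff, Fin.ext_iff, Fin.ext_iff]
    rfl
  · convert hder.map g using 1
    · simp only [Atom.map]
      congr 1
      funext i
      rw [← ht, hg]
    · ext ⟨p, a⟩
      constructor
      · rintro ⟨hp, ha, hb⟩
        have ha' : ∀ i, (a i : ℕ) < n := ha
        obtain ⟨a, rfl⟩ := exists_castLE hn.le ha'
        refine ⟨_, (hT.snd p hp a).1 hb, ?_⟩
        simp [Atom.map, hg]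
      · rintro ⟨⟨q, b⟩, hα, h⟩
        have hq := hedb _ (I.sub hα)
        obtain ⟨b, rfl⟩ := hfact q b (I.sub hα)
        have h : (⟨q, fun i => (b i).castLE hn.le⟩ : Atom ar (Fin (w.length + 1))) = ⟨p, a⟩ := by
          rw [← h]
          simp [Atom.map, hg]
        cases h
        exact ⟨hq, fun i => (b i).2, (hT.snd _ hq b).2 hα⟩

end Sentence

end WhyProv

end

theorem theorem2 {P : Type*} [Fintype P] [LinearOrder P] (ar : P → ℕ) (Q : WhyProv.Query ar)
    (hQ : Q.NonRecursive) : WhyProv.whyProvenance Q ∈ WhyProv.AC0 :=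
  WhyProv.mem_AC0_of_uDef <| (WhyProv.bitDef_encodesWhy hQ).congr fun _ _ =>
    ⟨WhyProv.exists_encodesWhy_of_mem, fun ⟨_, h⟩ => WhyProv.mem_whyProvenance_of_encodesWhy h⟩
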